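/- Let $n\ge 1$, $m_1,m_2\ge 0$ be integers, $R>0$. For $u,v\in\mathbb{C}^n$ let $u\circledast v$ be the circular convolution, $(u\circledast v)_k=\sum_j u_jv_{k-j}$ (indices modulo $n$), and let $F$ be the unitary $n\times n$ DFT matrix. For $D\in\mathbb{C}^{n\times m_1}$, $E\in\mathbb{C}^{n\times m_2}$ let $\mathcal{G}_{DE}:\mathbb{C}^{m_1\times m_2}\to\mathbb{C}^n$ be the linear operator with $\mathcal{G}_{DE}(xy^T)=(Dx)\circledast(Ey)$. Let $\Omega_{\mathcal X}\subset\mathbb{C}^{m_1}$, $\Omega_{\mathcal Y}\subset\mathbb{C}^{m_2}$ be given by one of the following scenarios, where $\|\cdot\|_0$ is the number of nonzero entries and the sparsity levels satisfy $s_1\le m_1$, $s_2\le m_2$: - subspace constraints: $\Omega_{\mathcal X}=\mathbb{C}^{m_1}$, $\Omega_{\mathcal Y}=\mathbb{C}^{m_2}$; - mixed constraints: $\Omega_{\mathcal X}=\{x:\|x\|_0\le s_1\}$, $\Omega_{\mathcal Y}=\mathbb{C}^{m_2}$; - sparsity constraints: $\Omega_{\mathcal X}=\{x:\|x\|_0\le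 s_1\}$, $\Omega_{\mathcal Y}=\{y:\|y\|_0\le s_2\}$. Let $\Omega_{\mathcal B}=\{xy^T: x\in\Omega_{\mathcal X},\,y\in\Omega_{\mathcal Y},\,\|xy^T\|_{\mathrm F}\le 1\}$. Below $\|\cdot\|_2$ is the Euclidean norm of a vector and the spectral norm of a matrix. Assume that $D$ and $E$ are independent random matrices such that the vectors $(FD)^{(j,:)*}$, $j=1,\dots,n$ (conjugate transposes of the rows of $FD$), are i.i.d. uniform on the ball of radius $R$ centred at the origin in $\mathbb{C}^{m_1}$, and the vectors $(FE)^{(j,:)*}$, $j=1,\dots,n$, are i.i.d. uniform on the ball of radius $R$ centred at the origin in $\mathbb{C}^{m_2}$. Let $\varepsilon>0$ and $0<\delta\le\frac23\sqrt n\,R^2$, and put $C=648\,m_1m_2\left(1+2\ln\frac{2\sqrt nR^2}{3\delta}\right)$. 1. If $n>d$, then for every $M_0\in\Omega_{\mathcal B}$, with probability at least $1-C'\left(\frac{\delta^2}{R^4}\right)^{n-d}\left(\frac1{\varepsilon^2}\right)^n$, the recovery of $M_0$ is stable: for all $M\in\Omega_{\mathcal B}$ with $\|\mathcal{G}_{DE}(M)-\mathcal{G}_{DE}(M_0)\|_2\le\delta$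 one has $\|M-M_0\|_2\le\varepsilon$. 2. If $n>2d$, then with probability at least $1-C''\left(\frac{\delta^2}{R^4}\right)^{n-2d}\left(\frac1{\varepsilon^2}\right)^n$ the recovery on $\Omega_{\mathcal B}$ is uniformly stable: for all $M_1,M_2\in\Omega_{\mathcal B}$ with $\|\mathcal{G}_{DE}(M_1)-\mathcal{G}_{DE}(M_2)\|_2\le\delta$ one has $\|M_1-M_2\|_2\le\varepsilon$. Here $d$, $C'$, $C''$ are: - subspace constraints: $d=m_1+m_2$, $C'=\frac{C^n}{n^{n-d}}$, $C''=\frac{(4C)^n}{n^{n-2d}}$; - mixed constraints: $d=s_1+m_2$, $C'=\binom{m_1}{s_1}^2\frac{C^n}{n^{n-d}}$, $C''=\binom{m_1}{s_1}^4\frac{(4C)^n}{n^{n-2d}}$; - sparsity constraints: $d=s_1+s_2$, $C'=\binom{m_1}{s_1}^2\binom{m_2}{s_2}^2\frac{C^n}{n^{n-d}}$, $C''=\binom{m_1}{s_1}^4\binom{m_2}{s_2}^4\frac{(4C)^n}{n^{n-2d}}$. -/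

import Mathlib

open MeasureTheory ProbabilityTheory

namespace BlindDeconv

/-- The product (Borel) sigma-algebra on complex matrices, entry by entry. -/
noncomputable instance instMeasurableSpaceMatrix (m₁ m₂ : ℕ) : MeasurableSpace (Matrix (Fin m₁) (Fin m₂) ℂ) :=
  inferInstanceAs (MeasurableSpace (Fin m₁ → Fin m₂ → ℂ))

/-- Euclidean norm of a complex vector. -/
noncomputable def l2Norm {m : ℕ} (x : Fin m → ℂ) : ℝ := ‖WithLp.toLp 2 x‖

open scoped Matrix.Norms.L2Operator in
/-- Spectral norm of a matrix (operator norm between Euclidean spaces). -/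
noncomputable def specNorm {m₁ m₂ : ℕ} (M : Matrix (Fin m₁) (Fin m₂) ℂ) : ℝ := ‖M‖

open scoped Matrix.Norms.Frobenius in
/-- Frobenius norm of a matrix. -/
noncomputable def frobNorm {m₁ m₂ : ℕ} (M : Matrix (Fin m₁) (Fin m₂) ℂ) : ℝ := ‖M‖

/-- The closed ball of radius `R` centred at the origin of `ℂ ^ m` (for the Euclidean norm). -/
def complexBall (m : ℕ) (R : ℝ) : Set (Fin m → ℂ) := {x | l2Norm x ≤ R}

/-- The unitary discrete Fourier transform matrix of size `n`. -/
noncomputable def dftMatrix (n : ℕ) : Matrix (Fin n) (Fin n) ℂ :=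
  Matrix.of fun j k =>
    Complex.exp (-2 * Real.pi * Complex.I * (j : ℕ) * (k : ℕ) / n) / (Real.sqrt n : ℂ)

/-- Circular convolution of two vectors of length `n`; the subtraction of indices in `Fin n` is
modulo `n`. -/
def circConv {n : ℕ} (u v : Fin n → ℂ) : Fin n → ℂ := fun k => ∑ j, u j * v (k - j)

/-- The linear measurement operator on `m₁ × m₂` matrices that sends `x yᵀ` to the circular
convolution of `D x` and `E y` (see `lifted_vecMulVec`). -/
noncomputable def lifted {n m₁ m₂ : ℕ} (D : Matrix (Fin n) (Fin m₁) ℂ)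
    (E : Matrix (Fin n) (Fin m₂) ℂ) : Matrix (Fin m₁) (Fin m₂) ℂ →ₗ[ℂ] (Fin n → ℂ) where
  toFun M := fun k => ∑ j, (D * M * E.transpose) j (k - j)
  map_add' M N := by
    funext k
    simp [Matrix.mul_add, Matrix.add_mul, Finset.sum_add_distrib]
  map_smul' c M := by
    funext k
    simp [Finset.mul_sum]

theorem lifted_vecMulVec {n m₁ m₂ : ℕ} (D : Matrix (Fin n) (Fin m₁) ℂ)
    (E : Matrix (Fin n) (Fin m₂) ℂ) (x : Fin m₁ → ℂ) (y : Fin m₂ → ℂ) :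
    lifted D E (Matrix.vecMulVec x y) = circConv (D.mulVec x) (E.mulVec y) := by
  funext k
  simp only [lifted, LinearMap.coe_mk, AddHom.coe_mk, circConv]
  rw [Matrix.mul_vecMulVec, Matrix.vecMulVec_mul, Matrix.vecMul_transpose]
  rfl

/-- The vector `(F A)^(j,:)*`: conjugate transpose of the `j`-th row of `F A`. -/
noncomputable def dftRow {n m : ℕ} (A : Matrix (Fin n) (Fin m) ℂ) (j : Fin n) : Fin m → ℂ :=
  fun i => star ((dftMatrix n * A) j i)

/-- The three constraint scenarios, with their sparsity levels. -/
inductive Scenario where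
  | subspace : Scenario
  | mixed (s₁ : ℕ) : Scenario
  | sparsity (s₁ s₂ : ℕ) : Scenario

namespace Scenario

/-- Vectors with at most `s` nonzero entries. -/
def sparseSet (m s : ℕ) : Set (Fin m → ℂ) := {x | hammingNorm x ≤ s}

/-- The constraint set for the coefficient vector `x` of the signal. -/
def signalSet (m₁ : ℕ) : Scenario → Set (Fin m₁ → ℂ)
  | subspace => Set.univ
  | mixed s₁ => sparseSet m₁ s₁
  | sparsity s₁ _ => sparseSet m₁ s₁

/-- The constraint set for the coefficient vector `y` of the filter. -/
def filterSet (m₂ : ℕ) : Scenario → Set (Fin m₂ → ℂ)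
  | subspace => Set.univ
  | mixed _ => Set.univ
  | sparsity _ s₂ => sparseSet m₂ s₂

/-- Sparsity levels do not exceed the dimensions. -/
def Admissible (m₁ m₂ : ℕ) : Scenario → Prop
  | subspace => True
  | mixed s₁ => s₁ ≤ m₁
  | sparsity s₁ s₂ => s₁ ≤ m₁ ∧ s₂ ≤ m₂

/-- The sample complexity bound `d`. -/
def d (m₁ m₂ : ℕ) : Scenario → ℕ
  | subspace => m₁ + m₂
  | mixed s₁ => s₁ + m₂
  | sparsity s₁ s₂ => s₁ + s₂

/-- The number of possible support patterns. -/
def supports (m₁ m₂ : ℕ) : Scenario → ℕ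
  | subspace => 1
  | mixed s₁ => m₁.choose s₁
  | sparsity s₁ s₂ => m₁.choose s₁ * m₂.choose s₂

/-- The constant `C = 648 m₁ m₂ (1 + 2 ln (2 √n R² / (3 δ)))`. -/
noncomputable def constC (n m₁ m₂ : ℕ) (R δ : ℝ) : ℝ :=
  648 * m₁ * m₂ * (1 + 2 * Real.log (2 * Real.sqrt n * R ^ 2 / (3 * δ)))

/-- The constant `C'` of single point stability. -/
noncomputable def constC' (S : Scenario) (n m₁ m₂ : ℕ) (R δ : ℝ) : ℝ :=
  (S.supports m₁ m₂ : ℝ) ^ 2 * (constC n m₁ m₂ R δ ^ n / (n : ℝ) ^ (n - S.d m₁ m₂))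

/-- The constant `C''` of uniform stability. -/
noncomputable def constC'' (S : Scenario) (n m₁ m₂ : ℕ) (R δ : ℝ) : ℝ :=
  (S.supports m₁ m₂ : ℝ) ^ 4 * ((4 * constC n m₁ m₂ R δ) ^ n / (n : ℝ) ^ (n - 2 * S.d m₁ m₂))

/-- The lifted constraint set intersected with the unit Frobenius ball. -/
def omegaB (m₁ m₂ : ℕ) (S : Scenario) : Set (Matrix (Fin m₁) (Fin m₂) ℂ) :=
  {M | (∃ x ∈ S.signalSet m₁, ∃ y ∈ S.filterSet m₂, M = Matrix.vecMulVec x y) ∧ frobNorm M ≤ 1}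

end Scenario

/-- Single point stability of the recovery of `M₀` from `G` on the constraint set `K`, at
levels `δ`, `ε`. -/
def StableAt {n m₁ m₂ : ℕ} (G : Matrix (Fin m₁) (Fin m₂) ℂ →ₗ[ℂ] (Fin n → ℂ))
    (K : Set (Matrix (Fin m₁) (Fin m₂) ℂ)) (δ ε : ℝ) (M₀ : Matrix (Fin m₁) (Fin m₂) ℂ) : Prop :=
  ∀ M ∈ K, l2Norm (G M - G M₀) ≤ δ → specNorm (M - M₀) ≤ ε

/-- Uniform stability of the recovery from `G` on the constraint set `K`, at levels `δ`, `ε`. -/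
def UniformlyStable {n m₁ m₂ : ℕ} (G : Matrix (Fin m₁) (Fin m₂) ℂ →ₗ[ℂ] (Fin n → ℂ))
    (K : Set (Matrix (Fin m₁) (Fin m₂) ℂ)) (δ ε : ℝ) : Prop :=
  ∀ M₁ ∈ K, ∀ M₂ ∈ K, l2Norm (G M₁ - G M₂) ≤ δ → specNorm (M₁ - M₂) ≤ ε

/-- The vectors `(F A)^(j,:)*`, `j = 1, …, n`, of the random matrix `A` are i.i.d., uniformly
distributed on the ball of radius `R` in `ℂ ^ m`. -/
def UniformDftRows {Ω : Type*} [MeasurableSpace Ω] (μ : Measure Ω) {n m : ℕ}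
    (A : Ω → Matrix (Fin n) (Fin m) ℂ) (R : ℝ) : Prop :=
  iIndepFun (fun (j : Fin n) (ω : Ω) => dftRow (A ω) j) μ ∧
    ∀ j : Fin n, pdf.IsUniform (fun ω => dftRow (A ω) j) (complexBall m R) μ volume

end BlindDeconv

/-! Since the operator is linear, instability yields a difference `X` of matrices of the constraint
set whose measurement is at most `δ` while its spectral norm exceeds `ε`. In the Fourier domain the
`j`-th coordinate of the measurement is `√n` times the form `a* X b̄` at the `j`-th rows
(`dftMatrix_mulVec_lifted`). A small measurement thus makes `n` independent copies of one random
form small simultaneously.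

A single copy is rarely small. A linear form in a uniform vector of the ball has modulus at most `s`
with probability of order `s²` (`cond_complexBall_linearForm_le`). Conditioning on `b` turns `a* X
b̄` into such a form in `a`, whose coefficient vector is itself bounded below by the modulus of a
linear form in `b`. Averaging the conditional bound over `b` costs a logarithm, which is the one in
`C` (`prod_cond_conjForm_le`).

Rank-one sparse matrices form a set of real dimension at most `2d`, so nets of radius of order `ρ =
δ / (2√n R²)` have about `ρ^(-2d)` points (`exists_net_omegaB`). Replacing `X` by a net point
changes each form by at most `ρR²`. The union bound (`measure_exists_nearly_annihilated_le`)
multiplies the number of points by the `n`-th power of the single-row probability. With `q = 4ρ²`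
this leaves `q^(n-d)` for one fixed matrix, and `q^(n-2d)` for pairs, whose net is squared in size.
`union_bound_le` checks the constants. -/

namespace BlindDeconv

/-! ### Nets of the unit ball, of sparse vectors and of the constraint set -/

open Metric Module in
/-- An `r`-separated subset of the unit ball has at most `(1 + 2 / r) ^ dim` elements. -/
theorem card_le_of_separated_unitBall {E : Type*} [NormedAddCommGroup E] [NormedSpace ℝ E]
    [FiniteDimensional ℝ E] {r : ℝ} (hr : 0 < r) (s : Finset E) (hs : ∀ c ∈ s, ‖c‖ ≤ 1)
    (h : ∀ c ∈ s, ∀ d ∈ s, c ≠ d → r ≤ ‖c - d‖) :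
    (s.card : ℝ) ≤ (1 + 2 / r) ^ finrank ℝ E := by
  borelize E
  let μ : Measure E := Measure.addHaar
  have hr2 : 0 < r / 2 := by positivity
  have hρ : 0 < 1 + r / 2 := by positivity
  set A := ⋃ c ∈ s, ball (c : E) (r / 2) with hA
  have hD : Set.Pairwise (s : Set E) (Function.onFun Disjoint fun c => ball (c : E) (r / 2)) := by
    rintro c hc d hd hcd
    apply ball_disjoint_ball
    rw [dist_eq_norm]
    linarith [h c hc d hd hcd]
  have hAs : A ⊆ ball (0 : E) (1 + r / 2) := by
    refine Set.iUnion₂_subset fun x hx => ball_subset_ball' ?_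
    rw [dist_zero_right]
    linarith [hs x hx]
  have hI : (s.card : ENNReal) * ENNReal.ofReal ((r / 2) ^ finrank ℝ E) * μ (ball 0 1) ≤
      ENNReal.ofReal ((1 + r / 2) ^ finrank ℝ E) * μ (ball 0 1) := by
    calc
      _ = μ A := by
        rw [hA, measure_biUnion_finset hD fun c _ => measurableSet_ball]
        simp only [μ.addHaar_ball_of_pos _ hr2, Finset.sum_const, nsmul_eq_mul, mul_assoc]
      _ ≤ μ (ball (0 : E) (1 + r / 2)) := measure_mono hAs
      _ = _ := by simp only [μ.addHaar_ball_of_pos _ hρ]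
  have hJ := (ENNReal.mul_le_mul_iff_left (measure_ball_pos μ (0 : E) zero_lt_one).ne'
    measure_ball_lt_top.ne).1 hI
  have hK := ENNReal.toReal_le_of_le_ofReal (by positivity) hJ
  rw [ENNReal.toReal_mul, ENNReal.toReal_natCast, ENNReal.toReal_ofReal (by positivity)] at hK
  rw [show 1 + 2 / r = (1 + r / 2) / (r / 2) by field_simp; ring, div_pow, le_div_iff₀ (by positivity)]
  exact hK

/-- The unit ball has an `r`-net of at most `(1 + 2 / r) ^ dim` of its points. -/
theorem exists_net_unitBall (E : Type*) [NormedAddCommGroup E] [NormedSpace ℝ E]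
    [FiniteDimensional ℝ E] {r : ℝ} (hr : 0 < r) :
    ∃ s : Finset E, (∀ c ∈ s, ‖c‖ ≤ 1) ∧ (∀ x : E, ‖x‖ ≤ 1 → ∃ c ∈ s, ‖x - c‖ ≤ r) ∧
      (s.card : ℝ) ≤ (1 + 2 / r) ^ Module.finrank ℝ E := by
  classical
  let P : Finset E → Prop := fun s =>
    (∀ c ∈ s, ‖c‖ ≤ 1) ∧ ∀ c ∈ s, ∀ d ∈ s, c ≠ d → r ≤ ‖c - d‖
  let K : Set ℕ := {k | ∃ s : Finset E, P s ∧ s.card = k}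
  have hK : BddAbove K := by
    refine ⟨⌊(1 + 2 / r) ^ Module.finrank ℝ E⌋₊, ?_⟩
    rintro k ⟨s, hs, rfl⟩
    exact Nat.le_floor (card_le_of_separated_unitBall hr s hs.1 hs.2)
  -- A separated set of maximal cardinality is a net: an uncovered point could be added to it.
  obtain ⟨s, hs, hcard⟩ := Nat.sSup_mem (s := K) ⟨0, ∅, by simp [P], rfl⟩ hK
  refine ⟨s, hs.1, fun x hx => ?_, card_le_of_separated_unitBall hr s hs.1 hs.2⟩
  by_contra! hcon
  have hxs : x ∉ s := fun hxs => by
    have := hcon x hxs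
    rw [sub_self, norm_zero] at this
    exact absurd this hr.not_gt
  have hmem : (insert x s).card ∈ K := by
    refine ⟨_, ⟨fun c hc => ?_, fun c hc d hd hcd => ?_⟩, rfl⟩
    · rcases Finset.mem_insert.1 hc with rfl | hc
      exacts [hx, hs.1 c hc]
    · rcases Finset.mem_insert.1 hc with rfl | hc' <;> rcases Finset.mem_insert.1 hd with rfl | hd'
      · exact absurd rfl hcd
      · exact (hcon d hd').le
      · rw [norm_sub_rev]; exact (hcon c hc').le
      · exact hs.2 c hc' d hd' hcd
  have := le_csSup hK hmem
  rw [Finset.card_insert_of_notMem hxs] at this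
  omega

theorem l2Norm_sq {m : ℕ} (x : Fin m → ℂ) : l2Norm x ^ 2 = ∑ i, ‖x i‖ ^ 2 := by
  rw [l2Norm, EuclideanSpace.norm_sq_eq]

theorem l2Norm_nonneg {m : ℕ} (x : Fin m → ℂ) : 0 ≤ l2Norm x := norm_nonneg _

theorem l2Norm_smul {m : ℕ} (c : ℂ) (x : Fin m → ℂ) : l2Norm (c • x) = ‖c‖ * l2Norm x := by
  rw [l2Norm, WithLp.toLp_smul, norm_smul, l2Norm]

theorem frobNorm_nonneg {m₁ m₂ : ℕ} (M : Matrix (Fin m₁) (Fin m₂) ℂ) : 0 ≤ frobNorm M := by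
  open scoped Matrix.Norms.Frobenius in
  exact norm_nonneg M

theorem frobNorm_add_le {m₁ m₂ : ℕ} (M N : Matrix (Fin m₁) (Fin m₂) ℂ) :
    frobNorm (M + N) ≤ frobNorm M + frobNorm N := by
  open scoped Matrix.Norms.Frobenius in
  exact norm_add_le M N

theorem frobNorm_sub_le {m₁ m₂ : ℕ} (M N : Matrix (Fin m₁) (Fin m₂) ℂ) :
    frobNorm (M - N) ≤ frobNorm M + frobNorm N := by
  open scoped Matrix.Norms.Frobenius in
  exact norm_sub_le M N

theorem frobNorm_sq {m₁ m₂ : ℕ} (M : Matrix (Fin m₁) (Fin m₂) ℂ) :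
    frobNorm M ^ 2 = ∑ i, ∑ j, ‖M i j‖ ^ 2 := by
  have h : frobNorm M = (∑ i, ∑ j, ‖M i j‖ ^ (2 : ℝ)) ^ (1 / 2 : ℝ) := Matrix.frobenius_norm_def M
  rw [h, ← Real.sqrt_eq_rpow, Real.sq_sqrt (by positivity)]
  simp

theorem frobNorm_vecMulVec {m₁ m₂ : ℕ} (x : Fin m₁ → ℂ) (y : Fin m₂ → ℂ) :
    frobNorm (Matrix.vecMulVec x y) = l2Norm x * l2Norm y := by
  refine (pow_left_inj₀ (frobNorm_nonneg _)
    (mul_nonneg (l2Norm_nonneg _) (l2Norm_nonneg _)) two_ne_zero).1 ?_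
  rw [frobNorm_sq, mul_pow, l2Norm_sq, l2Norm_sq, Finset.sum_mul_sum]
  simp [Matrix.vecMulVec_apply, mul_pow]

/-- The unit ball of the vectors with at most `s` nonzero entries has an `r`-net of at most
`(m choose s) (1 + 2 / r) ^ (2 s)` points of the unit ball. -/
theorem exists_net_sparse {m s : ℕ} (hsm : s ≤ m) {r : ℝ} (hr : 0 < r) :
    ∃ A : Finset (Fin m → ℂ), (∀ c ∈ A, l2Norm c ≤ 1) ∧
      (∀ x : Fin m → ℂ, hammingNorm x ≤ s → l2Norm x ≤ 1 → ∃ c ∈ A, l2Norm (x - c) ≤ r) ∧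
      (A.card : ℝ) ≤ m.choose s * (1 + 2 / r) ^ (2 * s) := by
  classical
  let ext : (T : Finset (Fin m)) → EuclideanSpace ℂ T → (Fin m → ℂ) :=
    fun T z i => if h : i ∈ T then z ⟨i, h⟩ else 0
  have hext : ∀ T z, l2Norm (ext T z) = ‖z‖ := fun T z => by
    refine (pow_left_inj₀ (l2Norm_nonneg _) (norm_nonneg _) two_ne_zero).1 ?_
    rw [l2Norm_sq, EuclideanSpace.norm_sq_eq, ← Finset.sum_subset (Finset.subset_univ T),
      ← Finset.sum_coe_sort T]
    · exact Finset.sum_congr rfl fun i _ => by simp [ext]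
    · intro i _ hi; simp [ext, hi]
  choose N hN1 hN2 hN3 using fun T : Finset (Fin m) => exists_net_unitBall (EuclideanSpace ℂ T) hr
  refine ⟨(Finset.univ.powersetCard s).biUnion fun T => (N T).image (ext T), ?_, ?_, ?_⟩
  · intro c hc
    simp only [Finset.mem_biUnion, Finset.mem_image] at hc
    obtain ⟨T, -, z, hz, rfl⟩ := hc
    rw [hext]; exact hN1 T z hz
  · intro x hx hx1
    -- Padding the support to exactly `s` indices, possible because `s ≤ m`, leaves only `m.choose
    -- s` coordinate subspaces to cover.
    obtain ⟨T, hT, hTs⟩ := Finset.exists_superset_card_eq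
      (s := Finset.univ.filter fun i => x i ≠ 0) (n := s) hx (by simpa using hsm)
    have hxT : ∀ c, x - ext T c = ext T (WithLp.toLp 2 (fun i : T => x i) - c) := fun c => by
      funext i
      by_cases hi : i ∈ T
      · simp [ext, hi]
      · have : x i = 0 := by
          by_contra hne
          exact hi (hT (by simpa using hne))
        simp [ext, hi, this]
    obtain ⟨c, hc, hxc⟩ := hN2 T (WithLp.toLp 2 fun i : T => x i) (by
      rw [← hext]
      have := hxT 0
      rw [sub_zero] at this
      rw [← this]
      convert hx1 using 2
      funext i
      simp [ext])
    refine ⟨ext T c, ?_, by rw [hxT, hext]; exact hxc⟩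
    simp only [Finset.mem_biUnion, Finset.mem_image]
    exact ⟨T, by simpa using hTs, c, hc, rfl⟩
  · have h1 := Finset.card_biUnion_le (s := (Finset.univ : Finset (Fin m)).powersetCard s)
      (t := fun T => (N T).image (ext T))
    calc _ ≤ ((∑ T ∈ (Finset.univ : Finset (Fin m)).powersetCard s,
            ((N T).image (ext T)).card : ℕ) : ℝ) := by exact_mod_cast h1
      _ ≤ ∑ T ∈ (Finset.univ : Finset (Fin m)).powersetCard s, (1 + 2 / r) ^ (2 * s) := by
          push_cast
          refine Finset.sum_le_sum fun T hT => ?_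
          refine (Nat.cast_le.2 Finset.card_image_le).trans ((hN3 T).trans_eq ?_)
          rw [finrank_real_of_complex, finrank_euclideanSpace, Fintype.card_coe,
            (Finset.mem_powersetCard.1 hT).2]
      _ = _ := by simp

/-- A matrix of the constraint set is an outer product of two vectors of the unit ball. -/
theorem exists_unitBall_of_mem_omegaB {m₁ m₂ s₁ s₂ : ℕ} {M : Matrix (Fin m₁) (Fin m₂) ℂ}
    (hM : M ∈ (Scenario.sparsity s₁ s₂).omegaB m₁ m₂) :
    ∃ x y, hammingNorm x ≤ s₁ ∧ hammingNorm y ≤ s₂ ∧ l2Norm x ≤ 1 ∧ l2Norm y ≤ 1 ∧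
      M = Matrix.vecMulVec x y := by
  obtain ⟨⟨x, hx, y, hy, rfl⟩, hxy⟩ := hM
  change hammingNorm x ≤ s₁ at hx
  change hammingNorm y ≤ s₂ at hy
  rw [frobNorm_vecMulVec] at hxy
  rcases (l2Norm_nonneg x).eq_or_lt with h0 | h0
  · have hx0 : x = 0 := by
      have : WithLp.toLp 2 x = 0 := norm_eq_zero.1 h0.symm
      simpa using this
    subst hx0
    exact ⟨0, 0, by simp, by simp, by simp [l2Norm], by simp [l2Norm], by simp⟩
  · have hc : (l2Norm x : ℂ) ≠ 0 := by exact_mod_cast h0.ne'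
    -- Normalize `x` and move its norm into `y`; the Frobenius bound then says that the new `y` lies
    -- in the unit ball.
    refine ⟨(l2Norm x : ℂ)⁻¹ • x, (l2Norm x : ℂ) • y, ?_, ?_, ?_, ?_, ?_⟩
    · exact (hammingNorm_smul_le_hammingNorm).trans hx
    · exact (hammingNorm_smul_le_hammingNorm).trans hy
    · rw [l2Norm_smul, norm_inv, Complex.norm_real, Real.norm_of_nonneg h0.le,
        inv_mul_cancel₀ h0.ne']
    · rw [l2Norm_smul, Complex.norm_real, Real.norm_of_nonneg h0.le]; exact hxy
    · rw [Matrix.smul_vecMulVec, Matrix.vecMulVec_smul, smul_smul, inv_mul_cancel₀ hc, one_smul]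

/-- The constraint set has a `ρ`-net in the Frobenius norm, inside the unit ball. -/
theorem exists_net_omegaB {m₁ m₂ s₁ s₂ : ℕ} (h₁ : s₁ ≤ m₁) (h₂ : s₂ ≤ m₂) {ρ : ℝ} (hρ : 0 < ρ) :
    ∃ A : Finset (Matrix (Fin m₁) (Fin m₂) ℂ), (∀ M ∈ A, frobNorm M ≤ 1) ∧
      (∀ M ∈ (Scenario.sparsity s₁ s₂).omegaB m₁ m₂, ∃ M' ∈ A, frobNorm (M - M') ≤ ρ) ∧
      (A.card : ℝ) ≤ (m₁.choose s₁ * m₂.choose s₂ : ℕ) * (1 + 4 / ρ) ^ (2 * (s₁ + s₂)) := by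
  classical
  obtain ⟨A, hA1, hA2, hA3⟩ := exists_net_sparse h₁ (half_pos hρ)
  obtain ⟨B, hB1, hB2, hB3⟩ := exists_net_sparse h₂ (half_pos hρ)
  refine ⟨(A ×ˢ B).image fun p => Matrix.vecMulVec p.1 p.2, ?_, ?_, ?_⟩
  · intro M hM
    simp only [Finset.mem_image, Finset.mem_product] at hM
    obtain ⟨p, hp, rfl⟩ := hM
    rw [frobNorm_vecMulVec]
    exact mul_le_one₀ (hA1 _ hp.1) (l2Norm_nonneg _) (hB1 _ hp.2)
  · intro M hM
    obtain ⟨x, y, hx, hy, hx1, hy1, rfl⟩ := exists_unitBall_of_mem_omegaB hM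
    obtain ⟨a, ha, hxa⟩ := hA2 x hx hx1
    obtain ⟨b, hb, hyb⟩ := hB2 y hy hy1
    refine ⟨Matrix.vecMulVec a b, Finset.mem_image_of_mem _ (Finset.mk_mem_product ha hb), ?_⟩
    have : Matrix.vecMulVec x y - Matrix.vecMulVec a b =
        Matrix.vecMulVec (x - a) y + Matrix.vecMulVec a (y - b) := by
      rw [Matrix.sub_vecMulVec, Matrix.vecMulVec_sub]; abel
    rw [this]
    refine (frobNorm_add_le _ _).trans ?_
    rw [frobNorm_vecMulVec, frobNorm_vecMulVec]
    have h1 := mul_le_mul hxa hy1 (l2Norm_nonneg _) (half_pos hρ).le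
    have h2 := mul_le_mul (hA1 a ha) hyb (l2Norm_nonneg _) zero_le_one
    linarith
  · refine (Nat.cast_le.2 Finset.card_image_le).trans ?_
    rw [Finset.card_product, Nat.cast_mul]
    refine (mul_le_mul hA3 hB3 (by positivity) (by positivity)).trans_eq ?_
    rw [show 2 / (ρ / 2) = 4 / ρ by field_simp; norm_num]
    push_cast
    ring

/-! ### Volumes of complex balls and anti-concentration of linear forms -/

theorem l2Norm_continuous {m : ℕ} : Continuous (l2Norm : (Fin m → ℂ) → ℝ) :=
  continuous_norm.comp (PiLp.continuous_toLp 2 _)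

theorem measurableSet_complexBall (m : ℕ) (R : ℝ) : MeasurableSet (complexBall m R) :=
  (isClosed_le l2Norm_continuous continuous_const).measurableSet

theorem volume_complexBall (m : ℕ) {R : ℝ} (hR : 0 ≤ R) :
    volume (complexBall m R) = ENNReal.ofReal (Real.pi ^ m * R ^ (2 * m) / m.factorial) := by
  -- Dimension zero is a one-point space of volume 1; it is needed below as the slice of a ball of
  -- `ℂ`.
  rcases m with _ | m
  · have : complexBall 0 R = Set.univ := by
      ext x
      simp [complexBall, l2Norm, EuclideanSpace.norm_eq, hR]
    rw [this, volume_pi, Measure.pi_univ]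
    simp
  · have h := Complex.volume_sum_rpow_le (Fin (m + 1)) one_le_two R
    have hset : complexBall (m + 1) R =
        {x : Fin (m + 1) → ℂ | (∑ i, ‖x i‖ ^ (2 : ℝ)) ^ (1 / (2 : ℝ)) ≤ R} := by
      ext x
      simp only [complexBall, l2Norm, EuclideanSpace.norm_eq, Real.sqrt_eq_rpow, Real.rpow_two,
        Set.mem_ofPred_eq]
    rw [hset, h, ← ENNReal.ofReal_pow hR, ← ENNReal.ofReal_mul (by positivity), Fintype.card_fin,
      mul_div_cancel_left₀ _ (two_ne_zero (α := ℝ)), div_self (two_ne_zero (α := ℝ)),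
      Real.Gamma_nat_eq_factorial, one_add_one_eq_two, Real.Gamma_two]
    congr 1
    ring

/-- Rotate the coordinates so that the linear form `a ↦ ∑ w i * a i` becomes a multiple of the
first coordinate. -/
theorem exists_rotation {m : ℕ} (w : Fin (m + 1) → ℂ) (hw : 0 < l2Norm w) :
    ∃ f : (Fin (m + 1) → ℂ) ≃ₗ[ℂ] (Fin (m + 1) → ℂ), (∀ a, l2Norm (f a) = l2Norm a) ∧
      ∀ a, ∑ i, w i * a i = l2Norm w * f a 0 := by
  let v : EuclideanSpace ℂ (Fin (m + 1)) :=
    ((l2Norm w : ℂ)⁻¹) • WithLp.toLp 2 (fun i => star (w i))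
  have hstar : ‖WithLp.toLp 2 (fun i => star (w i))‖ = l2Norm w := by
    rw [l2Norm, EuclideanSpace.norm_eq, EuclideanSpace.norm_eq]
    simp
  have hv : ‖v‖ = 1 := by
    rw [norm_smul, hstar, norm_inv, Complex.norm_real, Real.norm_of_nonneg hw.le,
      inv_mul_cancel₀ hw.ne']
  obtain ⟨b, hb⟩ := Orthonormal.exists_orthonormalBasis_extension_of_card_eq (𝕜 := ℂ)
    (E := EuclideanSpace ℂ (Fin (m + 1))) (ι := Fin (m + 1)) (by simp)
    (v := fun _ => v) (s := {0})
    ⟨fun i => hv, fun i j hij => absurd (Subsingleton.elim i j) hij⟩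
  refine ⟨((WithLp.linearEquiv 2 ℂ (Fin (m + 1) → ℂ)).symm.trans b.repr.toLinearEquiv).trans
    (WithLp.linearEquiv 2 ℂ (Fin (m + 1) → ℂ)), fun a => ?_, fun a => ?_⟩
  · exact b.repr.norm_map (WithLp.toLp 2 a)
  · have h0 : b 0 = v := hb 0 rfl
    change _ = _ * (b.repr (WithLp.toLp 2 a)) 0
    have hne : (l2Norm w : ℂ) ≠ 0 := by exact_mod_cast hw.ne'
    rw [b.repr_apply_apply, h0, inner_smul_left, map_inv₀, Complex.conj_ofReal, ← mul_assoc,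
      mul_inv_cancel₀ hne, one_mul, PiLp.inner_apply]
    refine Finset.sum_congr rfl fun i _ => ?_
    simp [mul_comm]

/-- A linear map scales volume by a constant factor, and this factor is 1 because the unit ball, of
positive finite volume, is its own preimage. -/
theorem volume_preimage_eq_of_l2Norm_eq {m : ℕ} (f : (Fin m → ℂ) ≃ₗ[ℂ] (Fin m → ℂ))
    (hf : ∀ a, l2Norm (f a) = l2Norm a) (s : Set (Fin m → ℂ)) :
    volume (f ⁻¹' s) = volume s := by
  let g : (Fin m → ℂ) ≃ₗ[ℝ] (Fin m → ℂ) := f.restrictScalars ℝ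
  have hdet : LinearMap.det (g : (Fin m → ℂ) →ₗ[ℝ] (Fin m → ℂ)) ≠ 0 :=
    (LinearEquiv.isUnit_det' g).ne_zero
  have h := fun s => Measure.addHaar_preimage_linearMap (volume : Measure (Fin m → ℂ)) hdet s
  have hB : f ⁻¹' complexBall m 1 = complexBall m 1 := by
    ext a
    simp [complexBall, hf]
  have h1 := h (complexBall m 1)
  have hvol := volume_complexBall m zero_le_one
  change volume (f ⁻¹' complexBall m 1) = _ at h1
  rw [hB] at h1
  have hc : ENNReal.ofReal |(LinearMap.det (g : (Fin m → ℂ) →ₗ[ℝ] (Fin m → ℂ)))⁻¹| = 1 := by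
    have hne : volume (complexBall m 1) ≠ 0 := by
      rw [hvol]; exact (ENNReal.ofReal_pos.2 (by positivity)).ne'
    have hnt : volume (complexBall m 1) ≠ ⊤ := by rw [hvol]; exact ENNReal.ofReal_ne_top
    nth_rewrite 1 [← one_mul (volume (complexBall m 1))] at h1
    exact ((ENNReal.mul_left_inj hne hnt).1 h1).symm
  have h2 := h s
  rw [hc, one_mul] at h2
  exact h2

/-- The slab lies in the product of a disc of radius `s` for the first coordinate and a ball of the
same radius `R` for the others. -/
theorem volume_complexBall_inter_le {m : ℕ} {R s : ℝ} (hs : 0 ≤ s) :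
    volume (complexBall (m + 1) R ∩ {a | ‖a 0‖ ≤ s}) ≤
      ENNReal.ofReal (Real.pi * s ^ 2) * volume (complexBall m R) := by
  have hmp := volume_preserving_piFinSuccAbove (fun _ : Fin (m + 1) => ℂ) 0
  have hsub : complexBall (m + 1) R ∩ {a | ‖a 0‖ ≤ s} ⊆
      (MeasurableEquiv.piFinSuccAbove (fun _ : Fin (m + 1) => ℂ) 0) ⁻¹'
        (Metric.closedBall 0 s ×ˢ complexBall m R) := by
    rintro a ⟨ha, has⟩
    refine ⟨by simpa [MeasurableEquiv.piFinSuccAbove] using has, ?_⟩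
    refine le_trans ?_ (show l2Norm a ≤ R from ha)
    refine (pow_le_pow_iff_left₀ (l2Norm_nonneg _) (l2Norm_nonneg _) two_ne_zero).1 ?_
    rw [l2Norm_sq, l2Norm_sq, Fin.sum_univ_succ]
    simp [MeasurableEquiv.piFinSuccAbove, Fin.tail]
  refine (measure_mono hsub).trans ?_
  rw [hmp.measure_preimage_equiv, Measure.volume_eq_prod, Measure.prod_prod,
    Complex.volume_closedBall]
  refine le_of_eq ?_
  congr 1
  rw [← ENNReal.ofReal_pow hs, mul_comm Real.pi, ENNReal.ofReal_mul (by positivity)]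
  congr 1
  rw [← NNReal.coe_real_pi, ENNReal.ofReal_coe_nnreal]

/-- Anti-concentration of a linear form of a uniform vector of the ball. -/
theorem cond_complexBall_linearForm_le {m : ℕ} (w : Fin m → ℂ) (hw : 0 < l2Norm w) {R s : ℝ}
    (hR : 0 < R) (hs : 0 ≤ s) :
    cond volume (complexBall m R) {a | ‖∑ i, w i * a i‖ ≤ s} ≤
      ENNReal.ofReal (m * s ^ 2 / (R ^ 2 * l2Norm w ^ 2)) := by
  rcases m with _ | m
  · rw [Subsingleton.elim w 0] at hw
    simp [l2Norm] at hw
  obtain ⟨f, hf, hfw⟩ := exists_rotation w hw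
  have hset : complexBall (m + 1) R ∩ {a | ‖∑ i, w i * a i‖ ≤ s} =
      f ⁻¹' (complexBall (m + 1) R ∩ {a | ‖a 0‖ ≤ s / l2Norm w}) := by
    ext a
    simp only [complexBall, Set.mem_inter_iff, Set.mem_ofPred_eq, Set.mem_preimage, hf, hfw,
      norm_mul, Complex.norm_real, Real.norm_of_nonneg hw.le, le_div_iff₀' hw]
  rw [cond_apply (measurableSet_complexBall _ _), hset, volume_preimage_eq_of_l2Norm_eq f hf]
  refine (mul_le_mul_right (volume_complexBall_inter_le (div_nonneg hs hw.le)) _).trans ?_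
  have hpos : 0 < Real.pi ^ (m + 1) * R ^ (2 * (m + 1)) / (m + 1).factorial := by positivity
  rw [volume_complexBall _ hR.le, volume_complexBall _ hR.le, ← ENNReal.ofReal_inv_of_pos hpos,
    ← ENNReal.ofReal_mul (by positivity), ← ENNReal.ofReal_mul (by positivity)]
  refine ENNReal.ofReal_le_ofReal (le_of_eq ?_)
  rw [Nat.factorial_succ]
  have := Real.pi_pos
  push_cast
  field_simp
  ring

/-! ### Anti-concentration of the bilinear form -/

theorem setLIntegral_ofReal_const_div {c α : ℝ} (hc : 0 ≤ c) (hα : 0 < α) (hα1 : α ≤ 1) :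
    ∫⁻ y in Set.Ioc α 1, ENNReal.ofReal (c / y) = ENNReal.ofReal (c * Real.log (1 / α)) := by
  have hint : IntervalIntegrable (fun y : ℝ => c / y) volume α 1 := by
    refine ContinuousOn.intervalIntegrable (continuousOn_const.div continuousOn_id fun y hy => ?_)
    rw [Set.uIcc_of_le hα1] at hy
    exact (hα.trans_le hy.1).ne'
  rw [← ofReal_integral_eq_lintegral_ofReal
    ((intervalIntegrable_iff_integrableOn_Ioc_of_le hα1).1 hint), ← intervalIntegral.integral_of_le hα1]
  · simp only [div_eq_mul_inv c, intervalIntegral.integral_const_mul]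
    rw [integral_inv_of_pos hα one_pos]
  · filter_upwards [ae_restrict_mem measurableSet_Ioc] with y hy
    exact div_nonneg hc (hα.trans hy.1).le

/-- The mean of `min 1 (α / U)` when the law of `U` has at most linear growth `k u`. -/
theorem lintegral_truncated_inv_le {β : Type*} [MeasurableSpace β] (ν : Measure β)
    [IsProbabilityMeasure ν] {U : β → ℝ} (hU : Measurable U) {k α : ℝ} (hk : 1 ≤ k) (hα : 0 < α)
    (hα1 : α ≤ 1) (hν : ∀ u, 0 < u → ν {b | U b ≤ u} ≤ ENNReal.ofReal (k * u)) :
    ∫⁻ b, ENNReal.ofReal (if U b ≤ α then 1 else α / U b) ∂ν ≤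
      ENNReal.ofReal (k * α * (1 + Real.log (1 / α))) := by
  have hnn : ∀ b, 0 ≤ (if U b ≤ α then 1 else α / U b) := fun b => by
    split_ifs with h
    · exact zero_le_one
    · exact div_nonneg hα.le (hα.trans (not_le.1 h)).le
  have hle1 : ∀ b, (if U b ≤ α then 1 else α / U b) ≤ 1 := fun b => by
    split_ifs with h
    · exact le_rfl
    · exact (div_le_one (hα.trans (not_le.1 h))).2 (not_le.1 h).le
  rw [lintegral_eq_lintegral_meas_le ν (Filter.Eventually.of_forall hnn)
    (Measurable.ite (measurableSet_le hU measurable_const) measurable_const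
      (measurable_const.div hU)).aemeasurable]
  -- Layer cake: the truncated quotient reaches level `y` only if `U ≤ α / y`. The trivial bound 1
  -- is used for `y ≤ α`, and integrating `kα / y` over the rest produces the logarithm.
  have hdom : ∀ y ∈ Set.Ioc (0 : ℝ) 1,
      ν {b | y ≤ if U b ≤ α then 1 else α / U b} ≤ ENNReal.ofReal (k * α / y) := fun y hy => by
    rw [mul_div_assoc]
    refine (measure_mono fun b hb => ?_).trans (hν (α / y) (div_pos hα hy.1))
    change y ≤ _ at hb
    change U b ≤ α / y
    rw [le_div_iff₀ hy.1]
    split_ifs at hb with h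
    · nlinarith [hy.1, hy.2]
    · rw [le_div_iff₀ (hα.trans (not_le.1 h))] at hb
      linarith
  have hsplit : Set.Ioi (0 : ℝ) = (Set.Ioc 0 α ∪ Set.Ioc α 1) ∪ Set.Ioi 1 := by
    rw [Set.Ioc_union_Ioc_eq_Ioc hα.le hα1, Set.Ioc_union_Ioi_eq_Ioi zero_le_one]
  rw [hsplit]
  refine (lintegral_union_le _ _ _).trans ?_
  have h3 : ∫⁻ y in Set.Ioi 1, ν {b | y ≤ if U b ≤ α then 1 else α / U b} = 0 := by
    rw [← lintegral_zero (μ := volume.restrict (Set.Ioi (1 : ℝ)))]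
    refine setLIntegral_congr_fun measurableSet_Ioi fun y hy => ?_
    have : {b | y ≤ if U b ≤ α then 1 else α / U b} = ∅ := by
      ext b
      simp only [Set.mem_ofPred_eq, Set.mem_empty_iff_false, iff_false, not_le]
      exact (hle1 b).trans_lt hy
    simp only [this, measure_empty]
  rw [h3, add_zero]
  refine (lintegral_union_le _ _ _).trans ?_
  have h1 : ∫⁻ y in Set.Ioc 0 α, ν {b | y ≤ if U b ≤ α then 1 else α / U b} ≤
      ENNReal.ofReal α := by
    refine (lintegral_mono fun y => prob_le_one).trans ?_
    simp
  have h2 : ∫⁻ y in Set.Ioc α 1, ν {b | y ≤ if U b ≤ α then 1 else α / U b} ≤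
      ENNReal.ofReal (k * α * Real.log (1 / α)) := by
    rw [← setLIntegral_ofReal_const_div (by positivity) hα hα1]
    exact setLIntegral_mono' measurableSet_Ioc fun y hy => hdom y ⟨hα.trans hy.1, hy.2⟩
  have hlog : 0 ≤ Real.log (1 / α) := Real.log_nonneg ((one_le_div hα).2 hα1)
  refine (add_le_add h1 h2).trans ?_
  rw [← ENNReal.ofReal_add hα.le (by positivity)]
  refine ENNReal.ofReal_le_ofReal ?_
  nlinarith

theorem isProbabilityMeasure_cond_complexBall (m : ℕ) {R : ℝ} (hR : 0 < R) :
    IsProbabilityMeasure (cond volume (complexBall m R)) := by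
  refine cond_isProbabilityMeasure_of_finite ?_ ?_ <;> rw [volume_complexBall m hR.le]
  · exact (ENNReal.ofReal_pos.2 (by positivity)).ne'
  · exact ENNReal.ofReal_ne_top

/-- The form `a, b ↦ a* M b̄`. -/
noncomputable def conjForm {m₁ m₂ : ℕ} (M : Matrix (Fin m₁) (Fin m₂) ℂ)
    (p : (Fin m₁ → ℂ) × (Fin m₂ → ℂ)) : ℂ :=
  ∑ i, ∑ k, star (p.1 i) * M i k * star (p.2 k)

theorem measurable_conjForm {m₁ m₂ : ℕ} (M : Matrix (Fin m₁) (Fin m₂) ℂ) :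
    Measurable (conjForm M) := by
  have : Continuous (conjForm M) := by unfold conjForm; fun_prop
  exact this.measurable

theorem norm_sum_mul_le {m : ℕ} (u v : Fin m → ℂ) : ‖∑ i, u i * v i‖ ≤ l2Norm u * l2Norm v := by
  refine (norm_sum_le _ _).trans ?_
  refine abs_le_of_sq_le_sq' ?_ (mul_nonneg (l2Norm_nonneg _) (l2Norm_nonneg _)) |>.2
  rw [mul_pow, l2Norm_sq, l2Norm_sq]
  simp only [norm_mul]
  exact Finset.sum_mul_sq_le_sq_mul_sq _ _ _

-- The strict inequality gives a near-maximizing vector of the adjoint, so the operator norm need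
-- not be shown to be attained.
open scoped Matrix.Norms.L2Operator in
theorem exists_lt_l2Norm_conjTranspose {m₁ m₂ : ℕ} {M : Matrix (Fin m₁) (Fin m₂) ℂ} {s : ℝ}
    (hs : s < specNorm M) :
    ∃ u : Fin m₁ → ℂ, l2Norm u ≤ 1 ∧ s < l2Norm (M.conjTranspose.mulVec u) := by
  have h : specNorm M = ‖M.conjTranspose‖ := (Matrix.l2_opNorm_conjTranspose M).symm
  rw [h, Matrix.l2_opNorm_def] at hs
  obtain ⟨u, hu, hsu⟩ := ContinuousLinearMap.exists_lt_apply_of_lt_opNorm _ hs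
  exact ⟨u.ofLp, hu.le, hsu⟩

/-- Anti-concentration of the form `a* M b̄` of independent uniform vectors of the balls. -/
theorem prod_cond_conjForm_le {m₁ m₂ : ℕ} (M : Matrix (Fin m₁) (Fin m₂) ℂ) {R s t : ℝ}
    (hm₁ : 1 ≤ m₁) (hm₂ : 1 ≤ m₂) (hR : 0 < R) (hs : 0 < s) (hsM : s < specNorm M) (ht : 0 < t)
    (hα1 : m₁ * t ^ 2 / (R ^ 4 * s ^ 2) ≤ 1) :
    ((cond volume (complexBall m₁ R)).prod (cond volume (complexBall m₂ R)))
        {p | ‖conjForm M p‖ ≤ t} ≤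
      ENNReal.ofReal (m₂ * (m₁ * t ^ 2 / (R ^ 4 * s ^ 2)) *
        (1 + Real.log (1 / (m₁ * t ^ 2 / (R ^ 4 * s ^ 2))))) := by
  have := isProbabilityMeasure_cond_complexBall m₁ hR
  have := isProbabilityMeasure_cond_complexBall m₂ hR
  have hm₁' : (1 : ℝ) ≤ m₁ := by exact_mod_cast hm₁
  have hm₂' : (1 : ℝ) ≤ m₂ := by exact_mod_cast hm₂
  set α := m₁ * t ^ 2 / (R ^ 4 * s ^ 2) with hαdef
  have hα : 0 < α := by positivity
  obtain ⟨u, hu, hsu⟩ := exists_lt_l2Norm_conjTranspose hsM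
  set c := M.conjTranspose.mulVec u with hc
  -- The normalization gives `U` the growth bound `m₂ v`, because `c` has norm above `s`; it also
  -- makes the conditional probability given `b` at most `α / U b`.
  let U : (Fin m₂ → ℂ) → ℝ := fun b => ‖∑ k, c k * b k‖ ^ 2 / (R ^ 2 * s ^ 2)
  have hU : Measurable U := by
    have : Continuous U := by dsimp only [U]; fun_prop
    exact this.measurable
  have hUlaw : ∀ v, 0 < v →
      cond volume (complexBall m₂ R) {b | U b ≤ v} ≤ ENNReal.ofReal (m₂ * v) := fun v hv => by
    have h1 : {b | U b ≤ v} = {b | ‖∑ k, c k * b k‖ ≤ R * s * Real.sqrt v} := by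
      ext b
      simp only [U, Set.mem_ofPred_eq]
      rw [div_le_iff₀ (by positivity), ← pow_le_pow_iff_left₀ (norm_nonneg _) (by positivity)
        (two_ne_zero (α := ℕ)), mul_pow, Real.sq_sqrt hv.le, mul_pow, mul_comm v]
    rw [h1]
    refine (cond_complexBall_linearForm_le c (hs.trans hsu) hR (by positivity)).trans
      (ENNReal.ofReal_le_ofReal ?_)
    have h2 : 0 < l2Norm c := hs.trans hsu
    rw [mul_pow, Real.sq_sqrt hv.le, div_le_iff₀ (by positivity)]
    have h3 : s ^ 2 ≤ l2Norm c ^ 2 := pow_le_pow_left₀ hs.le hsu.le 2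
    calc m₂ * ((R * s) ^ 2 * v) = m₂ * v * (R ^ 2 * s ^ 2) := by ring
      _ ≤ _ := by gcongr
  rw [Measure.prod_apply_symm (measurableSet_le (measurable_conjForm M).norm measurable_const)]
  refine le_trans (lintegral_mono fun b => ?_)
    (lintegral_truncated_inv_le _ hU hm₂' hα hα1 hUlaw)
  by_cases hUb : U b ≤ α
  · simp only [hUb, if_true, ENNReal.ofReal_one]
    exact prob_le_one
  · simp only [hUb, if_false]
    let w : Fin m₁ → ℂ := fun i => star (∑ k, M i k * star (b k))
    have hform : ∀ a, ‖conjForm M (a, b)‖ = ‖∑ i, w i * a i‖ := fun a => by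
      rw [← norm_star (∑ i, w i * a i), star_sum, conjForm]
      congr 1
      refine Finset.sum_congr rfl fun i _ => ?_
      simp only [w, star_mul', star_star, Finset.sum_mul]
      exact Finset.sum_congr rfl fun k _ => by ring
    -- Testing `w` against the unit-ball vector `u` bounds its norm below by a scalar linear form in
    -- `b`, whose law is controlled.
    have hcw : ‖∑ k, c k * b k‖ ≤ l2Norm w := by
      have : ∑ k, c k * b k = ∑ i, u i * w i := by
        simp only [hc, w, Matrix.mulVec, dotProduct, Matrix.conjTranspose_apply, star_sum,
          star_mul', star_star, Finset.mul_sum, Finset.sum_mul]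
        rw [Finset.sum_comm]
        exact Finset.sum_congr rfl fun i _ => Finset.sum_congr rfl fun k _ => by ring
      rw [this]
      refine (norm_sum_mul_le u w).trans ?_
      exact mul_le_of_le_one_left (l2Norm_nonneg _) hu
    have hUpos : 0 < U b := hα.trans (not_le.1 hUb)
    have hUw : U b * (R ^ 2 * s ^ 2) ≤ l2Norm w ^ 2 := by
      simp only [U]
      rw [div_mul_cancel₀ _ (by positivity)]
      exact pow_le_pow_left₀ (norm_nonneg _) hcw 2
    have hw : 0 < l2Norm w := by
      have : 0 < l2Norm w ^ 2 := lt_of_lt_of_le (by positivity) hUw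
      exact (l2Norm_nonneg w).lt_of_ne' fun h => by simp [h] at this
    have hset : (fun a => (a, b)) ⁻¹' {p | ‖conjForm M p‖ ≤ t} =
        {a | ‖∑ i, w i * a i‖ ≤ t} := by
      ext a
      simp only [Set.mem_preimage, Set.mem_ofPred_eq, hform]
    rw [hset]
    refine (cond_complexBall_linearForm_le w hw hR ht.le).trans (ENNReal.ofReal_le_ofReal ?_)
    rw [hαdef, div_div, div_le_div_iff_of_pos_left (by positivity) (by positivity) (by positivity)]
    calc R ^ 4 * s ^ 2 * U b = R ^ 2 * (U b * (R ^ 2 * s ^ 2)) := by ring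
      _ ≤ _ := by gcongr

/-- The logarithm is freed of `s` and `m₁`: `s ≤ 2` gives `1 / α ≤ 4 (R² / t)²`, and `1 + 2 ln 2 <
12 / 5`. For `α > 1` the right side exceeds 1. -/
theorem prod_cond_conjForm_le_log {m₁ m₂ : ℕ} (M : Matrix (Fin m₁) (Fin m₂) ℂ) {R s t : ℝ}
    (hm₁ : 1 ≤ m₁) (hm₂ : 1 ≤ m₂) (hR : 0 < R) (hs : 0 < s) (hs2 : s ≤ 2) (hsM : s < specNorm M)
    (ht : 0 < t) (htR : t ≤ R ^ 2) :
    ((cond volume (complexBall m₁ R)).prod (cond volume (complexBall m₂ R)))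
        {p | ‖conjForm M p‖ ≤ t} ≤
      ENNReal.ofReal (12 / 5 * (m₁ * m₂ * (1 + 2 * Real.log (R ^ 2 / t))) *
        (t ^ 2 / (R ^ 4 * s ^ 2))) := by
  have := isProbabilityMeasure_cond_complexBall m₁ hR
  have := isProbabilityMeasure_cond_complexBall m₂ hR
  have hm₁' : (1 : ℝ) ≤ m₁ := by exact_mod_cast hm₁
  have hm₂' : (1 : ℝ) ≤ m₂ := by exact_mod_cast hm₂
  have hlog : 0 ≤ Real.log (R ^ 2 / t) := Real.log_nonneg ((one_le_div ht).2 htR)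
  set α := m₁ * t ^ 2 / (R ^ 4 * s ^ 2) with hαdef
  have hα : 0 < α := by positivity
  have hrhs : 12 / 5 * (m₁ * m₂ * (1 + 2 * Real.log (R ^ 2 / t))) * (t ^ 2 / (R ^ 4 * s ^ 2)) =
      m₂ * α * (12 / 5 * (1 + 2 * Real.log (R ^ 2 / t))) := by
    rw [hαdef]; ring
  rw [hrhs]
  rcases le_or_gt α 1 with h1 | h1
  · refine (prod_cond_conjForm_le M hm₁ hm₂ hR hs hsM ht h1).trans (ENNReal.ofReal_le_ofReal ?_)
    refine mul_le_mul_of_nonneg_left ?_ (by positivity)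
    have h2 : 1 / α ≤ (R ^ 2 / t) ^ 2 * 2 ^ 2 := by
      rw [hαdef, one_div_div, div_le_iff₀ (by positivity)]
      have : (R ^ 2 / t) ^ 2 * 2 ^ 2 * (m₁ * t ^ 2) = m₁ * (R ^ 4 * 2 ^ 2) := by
        field_simp
      rw [this]
      calc R ^ 4 * s ^ 2 ≤ R ^ 4 * 2 ^ 2 := by gcongr
        _ ≤ _ := le_mul_of_one_le_left (by positivity) hm₁'
    have h3 := Real.log_le_log (by positivity) h2
    rw [Real.log_mul (by positivity) (by positivity), Real.log_pow, Real.log_pow] at h3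
    have h4 := Real.log_two_lt_d9
    push_cast at h3
    rw [← hαdef]
    linarith
  · refine prob_le_one.trans ?_
    rw [← ENNReal.ofReal_one]
    refine ENNReal.ofReal_le_ofReal ?_
    have : 1 ≤ m₂ * α := one_le_mul_of_one_le_of_one_le hm₂' h1.le
    exact one_le_mul_of_one_le_of_one_le this (by linarith)

/-! ### Fourier diagonalization -/

/-- Reducing `k + l` modulo `n` removes `n * q`, which changes the exponent by an integer multiple
of `2πi`. -/
theorem exp_dft_add {n : ℕ} [NeZero n] (j l k : Fin n) :
    Complex.exp (-2 * Real.pi * Complex.I * (j : ℕ) * ((k + l : Fin n) : ℕ) / n) =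
      Complex.exp (-2 * Real.pi * Complex.I * (j : ℕ) * (l : ℕ) / n) *
        Complex.exp (-2 * Real.pi * Complex.I * (j : ℕ) * (k : ℕ) / n) := by
  have hn : (n : ℂ) ≠ 0 := Nat.cast_ne_zero.2 (NeZero.ne n)
  rw [← Complex.exp_add, Complex.exp_eq_exp_iff_exists_int]
  obtain ⟨q, hq⟩ : ∃ q : ℕ, (k : ℕ) + l = (k + l : Fin n) + n * q :=
    ⟨((k : ℕ) + l) / n, by rw [Fin.val_add, Nat.mod_add_div]⟩
  refine ⟨(j : ℕ) * q, ?_⟩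
  have h : ((k : ℕ) : ℂ) + (l : ℕ) = ((k + l : Fin n) : ℕ) + n * (q : ℂ) := by exact_mod_cast hq
  rw [eq_sub_of_add_eq' h]
  push_cast
  field_simp
  ring

theorem dftMatrix_add {n : ℕ} [NeZero n] (j l k : Fin n) :
    dftMatrix n j (k + l) = Real.sqrt n * (dftMatrix n j l * dftMatrix n j k) := by
  have hn : (Real.sqrt n : ℂ) ≠ 0 := by
    simp [NeZero.ne n]
  simp only [dftMatrix, Matrix.of_apply, exp_dft_add]
  field_simp

/-- Fourier diagonalization of the lifted circular convolution. -/
theorem dftMatrix_mulVec_lifted {n m₁ m₂ : ℕ} (D : Matrix (Fin n) (Fin m₁) ℂ)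
    (E : Matrix (Fin n) (Fin m₂) ℂ) (M : Matrix (Fin m₁) (Fin m₂) ℂ) (j : Fin n) :
    (dftMatrix n).mulVec (lifted D E M) j = Real.sqrt n * conjForm M (dftRow D j, dftRow E j) := by
  have : NeZero n := ⟨by have := j.pos; omega⟩
  have h1 : conjForm M (dftRow D j, dftRow E j) =
      (dftMatrix n * (D * M * E.transpose) * (dftMatrix n).transpose) j j := by
    have : dftMatrix n * (D * M * E.transpose) * (dftMatrix n).transpose =
        (dftMatrix n * D) * M * (dftMatrix n * E).transpose := by
      rw [Matrix.transpose_mul]; simp only [Matrix.mul_assoc]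
    rw [this, Matrix.mul_apply]
    simp only [Matrix.mul_apply (M := dftMatrix n * D), Finset.sum_mul, conjForm, dftRow, star_star,
      Matrix.transpose_apply]
    exact Finset.sum_comm
  rw [h1]
  set P := D * M * E.transpose with hP
  have h2 : ∀ k, lifted D E M k = ∑ l, P l (k - l) := fun k => rfl
  simp only [Matrix.mulVec, dotProduct, h2, Finset.mul_sum]
  rw [Finset.sum_comm]
  simp only [Matrix.mul_apply, Matrix.transpose_apply, Finset.sum_mul, Finset.mul_sum]
  rw [Finset.sum_comm (γ := Fin n) (s := Finset.univ (α := Fin n)) (t := Finset.univ (α := Fin n))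
    (f := fun x i => (Real.sqrt n : ℂ) * (dftMatrix n j i * P i x * dftMatrix n j x))]
  refine Finset.sum_congr rfl fun l _ => ?_
  -- The cyclic shift `k ↦ k + l` decouples the convolution index, after which the character
  -- property splits the Fourier coefficient.
  rw [← Equiv.sum_comp (Equiv.addRight l)]
  refine Finset.sum_congr rfl fun k _ => ?_
  rw [Equiv.coe_addRight, add_sub_cancel_right, dftMatrix_add]
  ring

/-- Cauchy–Schwarz with unit rows suffices; unitarity of the whole matrix is not used. -/
theorem norm_dftMatrix_mulVec_le {n : ℕ} (u : Fin n → ℂ) (j : Fin n) :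
    ‖(dftMatrix n).mulVec u j‖ ≤ l2Norm u := by
  have hn : (0 : ℝ) < n := by exact_mod_cast j.pos
  have hrow : ∀ k, ‖dftMatrix n j k‖ = 1 / Real.sqrt n := fun k => by
    have : (-2 * Real.pi * Complex.I * (j : ℕ) * (k : ℕ) / n : ℂ) =
        ((-2 * Real.pi * (j : ℕ) * (k : ℕ) / n : ℝ) : ℂ) * Complex.I := by
      push_cast; ring
    rw [dftMatrix, Matrix.of_apply, norm_div, this, Complex.norm_exp_ofReal_mul_I,
      Complex.norm_real, Real.norm_of_nonneg (Real.sqrt_nonneg _)]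
  refine (norm_sum_mul_le (dftMatrix n j) u).trans (le_of_eq ?_)
  have : l2Norm (dftMatrix n j) = 1 := by
    refine (pow_left_inj₀ (l2Norm_nonneg _) zero_le_one two_ne_zero).1 ?_
    rw [l2Norm_sq]
    simp only [hrow, div_pow, Real.sq_sqrt hn.le, Finset.sum_const, Finset.card_univ,
      Fintype.card_fin, nsmul_eq_mul]
    field_simp
  rw [this, one_mul]

theorem norm_conjForm_dftRow_le {n m₁ m₂ : ℕ} (D : Matrix (Fin n) (Fin m₁) ℂ)
    (E : Matrix (Fin n) (Fin m₂) ℂ) (M : Matrix (Fin m₁) (Fin m₂) ℂ) (j : Fin n) :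
    Real.sqrt n * ‖conjForm M (dftRow D j, dftRow E j)‖ ≤ l2Norm (lifted D E M) := by
  have h := norm_dftMatrix_mulVec_le (lifted D E M) j
  rwa [dftMatrix_mulVec_lifted, norm_mul, Complex.norm_real,
    Real.norm_of_nonneg (Real.sqrt_nonneg _)] at h

/-! ### Joint law of the rows -/

theorem measurable_dftRow {n m : ℕ} (j : Fin n) :
    Measurable fun A : Matrix (Fin n) (Fin m) ℂ => dftRow A j := by
  refine measurable_pi_lambda _ fun i => ?_
  have h : ∀ k, Measurable fun A : Matrix (Fin n) (Fin m) ℂ => A k i := fun k =>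
    (measurable_pi_apply i).comp (measurable_pi_apply (X := fun _ : Fin n => Fin m → ℂ) k)
  simp only [dftRow, Matrix.mul_apply]
  exact (continuous_star.measurable).comp
    (Finset.measurable_sum _ fun k _ => measurable_const.mul (h k))

theorem map_dftRows {Ω : Type*} [MeasurableSpace Ω] {μ : Measure Ω} [IsProbabilityMeasure μ]
    {n m : ℕ} {A : Ω → Matrix (Fin n) (Fin m) ℂ} (hA : Measurable A) {R : ℝ}
    (hrows : UniformDftRows μ A R) :
    μ.map (fun ω j => dftRow (A ω) j) =
      Measure.pi fun _ : Fin n => cond volume (complexBall m R) := by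
  have h := (iIndepFun_iff_map_fun_eq_pi_map
    (fun j => ((measurable_dftRow j).comp hA).aemeasurable)).1 hrows.1
  refine h.trans ?_
  congr 1
  funext j
  exact hrows.2 j

/-- The event that all rows satisfy a condition has the product probability. -/
theorem measure_forall_dftRow {Ω : Type*} [MeasurableSpace Ω] {μ : Measure Ω}
    [IsProbabilityMeasure μ] {n m₁ m₂ : ℕ} {D : Ω → Matrix (Fin n) (Fin m₁) ℂ}
    {E : Ω → Matrix (Fin n) (Fin m₂) ℂ} (hD : Measurable D) (hE : Measurable E)
    (hDE : IndepFun D E μ) {R : ℝ} (hR : 0 < R) (hDrows : UniformDftRows μ D R)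
    (hErows : UniformDftRows μ E R) {s : Set ((Fin m₁ → ℂ) × (Fin m₂ → ℂ))}
    (hs : MeasurableSet s) :
    μ {ω | ∀ j, (dftRow (D ω) j, dftRow (E ω) j) ∈ s} =
      (((cond volume (complexBall m₁ R)).prod (cond volume (complexBall m₂ R))) s) ^ n := by
  have := isProbabilityMeasure_cond_complexBall m₁ hR
  have := isProbabilityMeasure_cond_complexBall m₂ hR
  have hmD : Measurable fun (A : Matrix (Fin n) (Fin m₁) ℂ) j => dftRow A j :=
    measurable_pi_lambda _ fun j => measurable_dftRow j
  have hmE : Measurable fun (A : Matrix (Fin n) (Fin m₂) ℂ) j => dftRow A j :=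
    measurable_pi_lambda _ fun j => measurable_dftRow j
  have hind := (hDE.comp hmD hmE)
  have hmap := (indepFun_iff_map_prod_eq_prod_map_map (hmD.comp hD).aemeasurable
    (hmE.comp hE).aemeasurable).1 hind
  have h1 : μ.map ((fun (A : Matrix (Fin n) (Fin m₁) ℂ) j => dftRow A j) ∘ D) = _ :=
    map_dftRows hD hDrows
  have h2 : μ.map ((fun (A : Matrix (Fin n) (Fin m₂) ℂ) j => dftRow A j) ∘ E) = _ :=
    map_dftRows hE hErows
  rw [h1, h2] at hmap
  -- Regrouping the two families of rows into one family of pairs turns the event into a box for a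
  -- product of `n` equal measures.
  let e := MeasurableEquiv.arrowProdEquivProdArrow (Fin m₁ → ℂ) (Fin m₂ → ℂ) (Fin n)
  have hmp := measurePreserving_arrowProdEquivProdArrow (Fin m₁ → ℂ) (Fin m₂ → ℂ) (Fin n)
    (fun _ => cond volume (complexBall m₁ R)) (fun _ => cond volume (complexBall m₂ R))
  have hset : {ω | ∀ j, (dftRow (D ω) j, dftRow (E ω) j) ∈ s} =
      (fun ω => (((fun (A : Matrix (Fin n) (Fin m₁) ℂ) j => dftRow A j) ∘ D) ω,
        ((fun (A : Matrix (Fin n) (Fin m₂) ℂ) j => dftRow A j) ∘ E) ω)) ⁻¹'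
        (e.symm ⁻¹' Set.univ.pi fun _ => s) := by
    ext ω
    simp only [Set.mem_preimage, Set.mem_univ_pi]
    rfl
  have hspi : MeasurableSet (Set.univ.pi fun _ : Fin n => s) :=
    MeasurableSet.univ_pi fun _ => hs
  rw [hset, ← Measure.map_apply ((hmD.comp hD).prodMk (hmE.comp hE)) (e.symm.measurable hspi), hmap,
    (hmp.symm e).measure_preimage hspi.nullMeasurableSet, Measure.pi_pi]
  simp

/-! ### Norm comparisons and the union bound -/

theorem l2Norm_mulVec_le {m₁ m₂ : ℕ} (M : Matrix (Fin m₁) (Fin m₂) ℂ) (v : Fin m₂ → ℂ) :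
    l2Norm (M.mulVec v) ≤ frobNorm M * l2Norm v := by
  refine (pow_le_pow_iff_left₀ (l2Norm_nonneg _)
    (mul_nonneg (frobNorm_nonneg _) (l2Norm_nonneg _)) two_ne_zero).1 ?_
  rw [mul_pow, l2Norm_sq, frobNorm_sq, Finset.sum_mul]
  refine Finset.sum_le_sum fun i _ => ?_
  rw [← l2Norm_sq, ← mul_pow]
  exact pow_le_pow_left₀ (norm_nonneg _) (norm_sum_mul_le (M i) v) 2

open scoped Matrix.Norms.L2Operator in
theorem specNorm_le_frobNorm {m₁ m₂ : ℕ} (M : Matrix (Fin m₁) (Fin m₂) ℂ) :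
    specNorm M ≤ frobNorm M := by
  rw [specNorm, Matrix.l2_opNorm_def]
  exact ContinuousLinearMap.opNorm_le_bound _ (frobNorm_nonneg M) fun v =>
    l2Norm_mulVec_le M v.ofLp

open scoped Matrix.Norms.L2Operator in
theorem specNorm_sub_le_specNorm {m₁ m₂ : ℕ} (X Z : Matrix (Fin m₁) (Fin m₂) ℂ) :
    specNorm X - specNorm (X - Z) ≤ specNorm Z := by
  have h := norm_sub_norm_le X (X - Z)
  rwa [sub_sub_cancel] at h

theorem norm_conjForm_le {m₁ m₂ : ℕ} (M : Matrix (Fin m₁) (Fin m₂) ℂ)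
    (a : Fin m₁ → ℂ) (b : Fin m₂ → ℂ) :
    ‖conjForm M (a, b)‖ ≤ frobNorm M * l2Norm a * l2Norm b := by
  have hstar : ∀ {m : ℕ} (x : Fin m → ℂ), l2Norm (fun i => star (x i)) = l2Norm x := fun x => by
    refine (pow_left_inj₀ (l2Norm_nonneg _) (l2Norm_nonneg _) two_ne_zero).1 ?_
    simp [l2Norm_sq]
  have h : conjForm M (a, b) = ∑ i, star (a i) * (M.mulVec fun k => star (b k)) i := by
    simp only [conjForm, Matrix.mulVec, dotProduct, Finset.mul_sum, mul_assoc]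
  rw [h]
  refine (norm_sum_mul_le (fun i => star (a i)) _).trans ?_
  rw [hstar]
  have := l2Norm_mulVec_le M fun k => star (b k)
  rw [hstar] at this
  calc _ ≤ l2Norm a * (frobNorm M * l2Norm b) :=
        mul_le_mul_of_nonneg_left this (l2Norm_nonneg a)
    _ = _ := by ring

theorem conjForm_sub {m₁ m₂ : ℕ} (M N : Matrix (Fin m₁) (Fin m₂) ℂ)
    (p : (Fin m₁ → ℂ) × (Fin m₂ → ℂ)) : conjForm (M - N) p = conjForm M p - conjForm N p := by
  simp only [conjForm, Matrix.sub_apply, mul_sub, sub_mul, Finset.sum_sub_distrib]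

theorem ae_dftRow_mem {Ω : Type*} [MeasurableSpace Ω] {μ : Measure Ω} {n m : ℕ}
    {A : Ω → Matrix (Fin n) (Fin m) ℂ} (hA : Measurable A) {R : ℝ}
    (hrows : UniformDftRows μ A R) : ∀ᵐ ω ∂μ, ∀ j, dftRow (A ω) j ∈ complexBall m R := by
  refine ae_all_iff.2 fun j => ?_
  refine ae_of_ae_map ((measurable_dftRow j).comp hA).aemeasurable ?_
  have h : μ.map (fun ω => dftRow (A ω) j) = _ := hrows.2 j
  change ∀ᵐ a ∂(μ.map (fun ω => dftRow (A ω) j)), a ∈ complexBall m R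
  rw [h]
  exact ae_cond_mem (measurableSet_complexBall m R)

/-- Union bound over a net for the event that the operator nearly annihilates a matrix of `K`
that is not small. -/
theorem measure_exists_nearly_annihilated_le {Ω : Type*} [MeasurableSpace Ω] {μ : Measure Ω}
    [IsProbabilityMeasure μ] {n m₁ m₂ : ℕ} (hn : 1 ≤ n) (hm₁ : 1 ≤ m₁) (hm₂ : 1 ≤ m₂)
    {D : Ω → Matrix (Fin n) (Fin m₁) ℂ} {E : Ω → Matrix (Fin n) (Fin m₂) ℂ}
    (hD : Measurable D) (hE : Measurable E) (hDE : IndepFun D E μ) {R : ℝ} (hR : 0 < R)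
    (hDrows : UniformDftRows μ D R) (hErows : UniformDftRows μ E R) {δ ε ρ : ℝ} (hδ : 0 < δ)
    (hδR : 3 * δ ≤ 2 * Real.sqrt n * R ^ 2) (hρ : ρ = δ / (2 * Real.sqrt n * R ^ 2)) (hρε : ρ < ε)
    (K : Set (Matrix (Fin m₁) (Fin m₂) ℂ)) (B : Finset (Matrix (Fin m₁) (Fin m₂) ℂ))
    (hB : ∀ Z ∈ B, frobNorm Z ≤ 2) (hKB : ∀ X ∈ K, ∃ Z ∈ B, frobNorm (X - Z) ≤ ρ) :
    μ {ω | ∃ X ∈ K, l2Norm (lifted (D ω) (E ω) X) ≤ δ ∧ ε < specNorm X} ≤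
      B.card * ENNReal.ofReal (27 / 5 *
        (m₁ * m₂ * (1 + 2 * Real.log (2 * Real.sqrt n * R ^ 2 / (3 * δ)))) *
        (δ ^ 2 / (n * R ^ 4)) / (ε - ρ) ^ 2) ^ n := by
  classical
  have hn' : (0 : ℝ) < n := by exact_mod_cast hn
  have hsn : 0 < Real.sqrt n := Real.sqrt_pos.2 hn'
  have hsn2 : Real.sqrt n ^ 2 = n := Real.sq_sqrt hn'.le
  -- The threshold is `δ / √n` from the measurement plus `ρR² = δ / (2√n)` from the net error; `hδR`
  -- says exactly `t ≤ R²`.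
  set t := 3 * δ / (2 * Real.sqrt n) with ht
  have htpos : 0 < t := by positivity
  have htR : t ≤ R ^ 2 := by
    rw [ht, div_le_iff₀ (by positivity)]; linarith
  have hlog : 2 * Real.sqrt n * R ^ 2 / (3 * δ) = R ^ 2 / t := by
    rw [ht]; field_simp
  have ht2 : 12 / 5 * t ^ 2 = 27 / 5 * (δ ^ 2 / n) := by
    rw [ht, div_pow, mul_pow, mul_pow, hsn2]; field_simp; norm_num
  -- The inclusion holds only almost everywhere, since the rows lie in the ball almost surely.
  have hsub : ∀ᵐ ω ∂μ, ω ∈ {ω | ∃ X ∈ K, l2Norm (lifted (D ω) (E ω) X) ≤ δ ∧ ε < specNorm X} →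
      ω ∈ ⋃ Z ∈ B.filter (fun Z => ε - ρ < specNorm Z),
        {ω | ∀ j, (dftRow (D ω) j, dftRow (E ω) j) ∈ {p | ‖conjForm Z p‖ ≤ t}} := by
    filter_upwards [ae_dftRow_mem hD hDrows, ae_dftRow_mem hE hErows] with ω hωD hωE hω
    obtain ⟨X, hX, hXδ, hXε⟩ := hω
    obtain ⟨Z, hZ, hXZ⟩ := hKB X hX
    have hsZ : ε - ρ < specNorm Z := by
      have h1 := specNorm_sub_le_specNorm X Z
      have h2 := specNorm_le_frobNorm (X - Z)
      linarith
    refine Set.mem_iUnion₂.2 ⟨Z, Finset.mem_filter.2 ⟨hZ, hsZ⟩, fun j => ?_⟩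
    have h1 : ‖conjForm X (dftRow (D ω) j, dftRow (E ω) j)‖ ≤ δ / Real.sqrt n := by
      rw [le_div_iff₀' hsn]
      exact (norm_conjForm_dftRow_le _ _ _ j).trans hXδ
    have h2 : ‖conjForm (X - Z) (dftRow (D ω) j, dftRow (E ω) j)‖ ≤ ρ * R * R := by
      refine (norm_conjForm_le _ _ _).trans ?_
      have hρ0 : 0 ≤ ρ := (frobNorm_nonneg _).trans hXZ
      exact mul_le_mul (mul_le_mul hXZ (hωD j) (l2Norm_nonneg _) hρ0) (hωE j) (l2Norm_nonneg _)
        (by positivity)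
    have h3 : ρ * R * R = δ / (2 * Real.sqrt n) := by rw [hρ]; field_simp
    have h4 : conjForm Z (dftRow (D ω) j, dftRow (E ω) j) =
        conjForm X (dftRow (D ω) j, dftRow (E ω) j) -
          conjForm (X - Z) (dftRow (D ω) j, dftRow (E ω) j) := by
      rw [conjForm_sub]; ring
    have h5 : δ / Real.sqrt n + δ / (2 * Real.sqrt n) = t := by
      rw [ht]; field_simp; norm_num
    rw [h4]
    refine (norm_sub_le _ _).trans ?_
    linarith
  refine (measure_mono_ae hsub).trans ((measure_biUnion_finset_le _ _).trans ?_)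
  refine (Finset.sum_le_card_nsmul _ _ (ENNReal.ofReal (27 / 5 *
    (m₁ * m₂ * (1 + 2 * Real.log (2 * Real.sqrt n * R ^ 2 / (3 * δ)))) *
    (δ ^ 2 / (n * R ^ 4)) / (ε - ρ) ^ 2) ^ n) fun Z hZ => ?_).trans ?_
  · obtain ⟨hZB, hsZ⟩ := Finset.mem_filter.1 hZ
    rw [measure_forall_dftRow hD hE hDE hR hDrows hErows
      (measurableSet_le (measurable_conjForm Z).norm measurable_const)]
    refine pow_le_pow_left' ?_ n
    have hs2 : ε - ρ ≤ 2 := hsZ.le.trans ((specNorm_le_frobNorm Z).trans (hB Z hZB))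
    refine (prod_cond_conjForm_le_log Z hm₁ hm₂ hR (sub_pos.2 hρε) hs2 hsZ htpos htR).trans
      (ENNReal.ofReal_le_ofReal (le_of_eq ?_))
    rw [hlog]
    have hs : ε - ρ ≠ 0 := (sub_pos.2 hρε).ne'
    calc _ = m₁ * m₂ * (1 + 2 * Real.log (R ^ 2 / t)) * (12 / 5 * t ^ 2) /
          (R ^ 4 * (ε - ρ) ^ 2) := by ring
      _ = _ := by rw [ht2]; field_simp
  · rw [nsmul_eq_mul]
    gcongr
    exact Finset.filter_subset _ _

/-- The numerical comparison of the union bound with the claimed failure probability, when the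
latter is nontrivial. -/
theorem union_bound_le {n e : ℕ} (hen : e < n) {q W N ε ρ κ l c : ℝ} (hq : 0 < q) (hq1 : q ≤ 1)
    (hW : 1 ≤ W) (hN : 1 ≤ N) (hε : 0 < ε) (hρq : 4 * ρ ^ 2 = q) (hκ : 1 ≤ κ)
    (hl : 648 ≤ l) (hκl : 13500 / 2401 * κ ≤ l) (hc : c ≤ N * (κ / q) ^ e)
    (hT : N * (l * W) ^ n * q ^ (n - e) * (1 / ε ^ 2) ^ n < 1) :
    ρ < ε ∧ c * (27 / 5 * W * q / (ε - ρ) ^ 2) ^ n ≤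
      N * (l * W) ^ n * q ^ (n - e) * (1 / ε ^ 2) ^ n := by
  have hl0 : 0 < l := by linarith
  have hW0 : 0 < W := by linarith
  -- A nontrivial bound forces `ε` to be large against `ρ`: as `l ≥ 648` and `4ρ² = q`, `ε² > 2592
  -- ρ² ≥ (50ρ)²`. Replacing `ε - ρ` by `49ε / 50` then turns `27 / 5` into `13500 / 2401`.
  have hlt : l * q < ε ^ 2 := by
    have h1 : (l * q / ε ^ 2) ^ n < 1 := by
      calc (l * q / ε ^ 2) ^ n = 1 * (l * 1) ^ n * q ^ n * (1 / ε ^ 2) ^ n := by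
            rw [one_mul, ← mul_pow, ← mul_pow]; ring
        _ ≤ N * (l * W) ^ n * q ^ (n - e) * (1 / ε ^ 2) ^ n := by
            gcongr ?_ * (l * ?_) ^ n * ?_ * _
            exact pow_le_pow_of_le_one hq.le hq1 (Nat.sub_le n e)
        _ < 1 := hT
    have h2 := (pow_lt_one_iff_of_nonneg (by positivity) (by omega)).1 h1
    rwa [div_lt_one (by positivity)] at h2
  have hρε : 50 * ρ < ε := by
    refine lt_of_pow_lt_pow_left₀ 2 hε.le ?_
    nlinarith
  have hs : 49 / 50 * ε ≤ ε - ρ := by linarith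
  refine ⟨by linarith, ?_⟩
  have hp : 27 / 5 * W * q / (ε - ρ) ^ 2 ≤ 13500 / 2401 * W * q * (1 / ε ^ 2) := by
    calc 27 / 5 * W * q / (ε - ρ) ^ 2 ≤ 27 / 5 * W * q / (49 / 50 * ε) ^ 2 := by gcongr
      _ = _ := by field_simp; norm_num
  have hqn : q ^ n = q ^ (n - e) * q ^ e := by rw [← pow_add, Nat.sub_add_cancel hen.le]
  calc c * (27 / 5 * W * q / (ε - ρ) ^ 2) ^ n
      ≤ N * (κ / q) ^ e * (13500 / 2401 * W * q * (1 / ε ^ 2)) ^ n := by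
        have : 0 ≤ 27 / 5 * W * q / (ε - ρ) ^ 2 := by positivity
        gcongr
    _ = N * (κ ^ e * (13500 / 2401 * W) ^ n) * q ^ (n - e) * (1 / ε ^ 2) ^ n := by
        rw [div_pow, mul_pow _ (1 / ε ^ 2), mul_pow _ q, hqn]
        field_simp
    _ ≤ N * (κ ^ n * (13500 / 2401 * W) ^ n) * q ^ (n - e) * (1 / ε ^ 2) ^ n := by
        gcongr
    _ = N * (13500 / 2401 * κ * W) ^ n * q ^ (n - e) * (1 / ε ^ 2) ^ n := by
        rw [← mul_pow]; ring
    _ ≤ _ := by gcongr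

/-- Common core of both statements, with `e` the exponent of the net size, `N` counting supports and
`r` the factor in front of `C`. -/
theorem one_sub_le_measureReal_of_net {Ω : Type*} [MeasurableSpace Ω] {μ : Measure Ω}
    [IsProbabilityMeasure μ] {n m₁ m₂ e : ℕ} (hen : e < n)
    {D : Ω → Matrix (Fin n) (Fin m₁) ℂ} {E : Ω → Matrix (Fin n) (Fin m₂) ℂ}
    (hD : Measurable D) (hE : Measurable E) (hDE : IndepFun D E μ) {R : ℝ} (hR : 0 < R)
    (hDrows : UniformDftRows μ D R) (hErows : UniformDftRows μ E R) {δ ε ρ : ℝ} (hδ : 0 < δ)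
    (hδR : 3 * δ ≤ 2 * Real.sqrt n * R ^ 2) (hε : 0 < ε) (hρ : ρ = δ / (2 * Real.sqrt n * R ^ 2))
    (K : Set (Matrix (Fin m₁) (Fin m₂) ℂ)) (B : Finset (Matrix (Fin m₁) (Fin m₂) ℂ))
    (hB : ∀ Z ∈ B, frobNorm Z ≤ 2) (hKB : ∀ X ∈ K, ∃ Z ∈ B, frobNorm (X - Z) ≤ ρ)
    {N κ r : ℝ} (hN : 1 ≤ N) (hκ : 1 ≤ κ) (hr : 1 ≤ r) (hκr : 13500 / 2401 * κ ≤ r * 648)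
    (hcard : (B.card : ℝ) ≤ N * (κ / (4 * ρ ^ 2)) ^ e) :
    1 - N * ((r * Scenario.constC n m₁ m₂ R δ) ^ n / (n : ℝ) ^ (n - e)) *
        (δ ^ 2 / R ^ 4) ^ (n - e) * (1 / ε ^ 2) ^ n ≤
      μ.real {ω | ∀ X ∈ K, l2Norm (lifted (D ω) (E ω) X) ≤ δ → specNorm X ≤ ε} := by
  have hn : 1 ≤ n := by omega
  have hn' : (0 : ℝ) < n := by exact_mod_cast hn
  have hsn : 0 < Real.sqrt n := Real.sqrt_pos.2 hn'
  have hsn2 : Real.sqrt n ^ 2 = n := Real.sq_sqrt hn'.le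
  have hlog : 0 ≤ Real.log (2 * Real.sqrt n * R ^ 2 / (3 * δ)) :=
    Real.log_nonneg ((one_le_div (by positivity)).2 hδR)
  set W : ℝ := m₁ * m₂ * (1 + 2 * Real.log (2 * Real.sqrt n * R ^ 2 / (3 * δ))) with hWdef
  have hC : Scenario.constC n m₁ m₂ R δ = 648 * W := by rw [Scenario.constC, hWdef]; ring
  set q : ℝ := δ ^ 2 / (n * R ^ 4) with hq
  have hT : N * ((r * Scenario.constC n m₁ m₂ R δ) ^ n / (n : ℝ) ^ (n - e)) *
      (δ ^ 2 / R ^ 4) ^ (n - e) * (1 / ε ^ 2) ^ n =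
      N * (r * 648 * W) ^ n * q ^ (n - e) * (1 / ε ^ 2) ^ n := by
    have : q = δ ^ 2 / R ^ 4 / n := by rw [hq]; field_simp
    rw [hC, this, div_pow _ (n : ℝ)]
    ring
  rw [hT]
  have hT0 : 0 ≤ N * (r * 648 * W) ^ n * q ^ (n - e) * (1 / ε ^ 2) ^ n := by positivity
  -- Here `C = 0`, so certainty is claimed; it holds because every matrix has norm zero.
  by_cases hm : m₁ = 0 ∨ m₂ = 0
  · have huniv : {ω | ∀ X ∈ K, l2Norm (lifted (D ω) (E ω) X) ≤ δ → specNorm X ≤ ε} = Set.univ := by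
      refine Set.eq_univ_of_forall fun ω X _ _ => ?_
      have hX : frobNorm X = 0 := by
        refine (pow_eq_zero_iff two_ne_zero).1 ?_
        rw [frobNorm_sq]
        rcases hm with rfl | rfl <;> simp
      linarith [specNorm_le_frobNorm X]
    rw [huniv, probReal_univ]
    linarith
  push Not at hm
  have hm₁ : 1 ≤ m₁ := Nat.one_le_iff_ne_zero.2 hm.1
  have hm₂ : 1 ≤ m₂ := Nat.one_le_iff_ne_zero.2 hm.2
  rcases le_or_gt 1 (N * (r * 648 * W) ^ n * q ^ (n - e) * (1 / ε ^ 2) ^ n) with h1 | h1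
  · exact (sub_nonpos.2 h1).trans measureReal_nonneg
  have hW : 1 ≤ W := by
    have h1 : (1 : ℝ) ≤ m₁ := by exact_mod_cast hm₁
    have h2 : (1 : ℝ) ≤ m₂ := by exact_mod_cast hm₂
    exact one_le_mul_of_one_le_of_one_le (one_le_mul_of_one_le_of_one_le h1 h2) (by linarith)
  have hρ0 : 0 < ρ := by rw [hρ]; positivity
  have hρq : 4 * ρ ^ 2 = q := by
    rw [hρ, hq, div_pow, mul_pow, mul_pow, hsn2]
    field_simp
    norm_num
  have hq0 : 0 < q := by rw [hq]; positivity
  have hρ3 : ρ ≤ 1 / 3 := by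
    rw [hρ, div_le_iff₀ (by positivity)]; linarith
  have hq1 : q ≤ 1 := by nlinarith
  rw [hρq] at hcard
  obtain ⟨hρε, hle⟩ := union_bound_le hen hq0 hq1 hW hN hε hρq hκ (by linarith) hκr
    hcard h1
  have hbad := measure_exists_nearly_annihilated_le hn hm₁ hm₂ hD hE hDE hR hDrows hErows hδ hδR hρ
    hρε K B hB hKB
  set bad := {ω | ∃ X ∈ K, l2Norm (lifted (D ω) (E ω) X) ≤ δ ∧ ε < specNorm X} with hbaddef
  have hbadR : μ.real bad ≤ N * (r * 648 * W) ^ n * q ^ (n - e) * (1 / ε ^ 2) ^ n := by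
    refine le_trans ?_ hle
    have hp : 0 ≤ 27 / 5 * W * q / (ε - ρ) ^ 2 := by positivity
    refine ENNReal.toReal_le_of_le_ofReal (by positivity) (hbad.trans_eq ?_)
    rw [ENNReal.ofReal_mul (Nat.cast_nonneg _), ENNReal.ofReal_natCast, ENNReal.ofReal_pow hp]
  -- Covering the space by two events needs only subadditivity, so no measurability of the stability
  -- event.
  have hunion : {ω | ∀ X ∈ K, l2Norm (lifted (D ω) (E ω) X) ≤ δ → specNorm X ≤ ε} ∪ bad =
      Set.univ := by
    ext ω
    simp only [hbaddef, Set.mem_union, Set.mem_ofPred_eq, Set.mem_univ, iff_true]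
    by_contra! h
    obtain ⟨⟨X, hX, hXδ, hXε⟩, h2⟩ := h
    exact absurd (h2 X hX hXδ) hXε.not_ge
  have htot := measureReal_union_le (μ := μ)
    {ω | ∀ X ∈ K, l2Norm (lifted (D ω) (E ω) X) ≤ δ → specNorm X ≤ ε} bad
  rw [hunion, probReal_univ] at htot
  linarith

/-! ### Reduction to the sparsity scenario and conclusion -/

/-- Every scenario is the sparsity scenario for suitable sparsity levels. -/
theorem Scenario.exists_sparsity {m₁ m₂ : ℕ} (S : Scenario) (hS : S.Admissible m₁ m₂) :
    ∃ s₁ s₂, s₁ ≤ m₁ ∧ s₂ ≤ m₂ ∧ S.omegaB m₁ m₂ = (Scenario.sparsity s₁ s₂).omegaB m₁ m₂ ∧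
      S.d m₁ m₂ = s₁ + s₂ ∧ S.supports m₁ m₂ = m₁.choose s₁ * m₂.choose s₂ := by
  have huniv : ∀ m, Scenario.sparseSet m m = Set.univ := fun m =>
    Set.eq_univ_of_forall fun x => hammingNorm_le_card_fintype.trans_eq (Fintype.card_fin m)
  cases S with
  | subspace =>
    refine ⟨m₁, m₂, le_rfl, le_rfl, ?_, rfl, by simp [supports]⟩
    simp only [omegaB, signalSet, filterSet, huniv]
  | mixed s₁ =>
    refine ⟨s₁, m₂, hS, le_rfl, ?_, rfl, by simp [supports]⟩
    simp only [omegaB, signalSet, filterSet, huniv]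
  | sparsity s₁ s₂ => exact ⟨s₁, s₂, hS.1, hS.2, rfl, rfl, rfl⟩

end BlindDeconv

theorem theorem4 {Ω : Type*} [MeasurableSpace Ω] (μ : Measure Ω) [IsProbabilityMeasure μ]
    (n m₁ m₂ : ℕ) (S : BlindDeconv.Scenario) (hS : S.Admissible m₁ m₂)
    (D : Ω → Matrix (Fin n) (Fin m₁) ℂ) (E : Ω → Matrix (Fin n) (Fin m₂) ℂ)
    (hD : Measurable D) (hE : Measurable E) (hDE : IndepFun D E μ)
    (R : ℝ) (hR : 0 < R)
    (hDrows : BlindDeconv.UniformDftRows μ D R) (hErows : BlindDeconv.UniformDftRows μ E R)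
    (δ ε : ℝ) (hδ : 0 < δ) (hδR : 3 * δ ≤ 2 * Real.sqrt n * R ^ 2) (hε : 0 < ε) :
    (S.d m₁ m₂ < n → ∀ M₀ ∈ S.omegaB m₁ m₂,
      1 - S.constC' n m₁ m₂ R δ * (δ ^ 2 / R ^ 4) ^ (n - S.d m₁ m₂) * (1 / ε ^ 2) ^ n ≤
        μ.real {ω | BlindDeconv.StableAt (BlindDeconv.lifted (D ω) (E ω))
          (S.omegaB m₁ m₂) δ ε M₀}) ∧
    (2 * S.d m₁ m₂ < n →
      1 - S.constC'' n m₁ m₂ R δ * (δ ^ 2 / R ^ 4) ^ (n - 2 * S.d m₁ m₂) * (1 / ε ^ 2) ^ n ≤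
        μ.real {ω | BlindDeconv.UniformlyStable (BlindDeconv.lifted (D ω) (E ω))
          (S.omegaB m₁ m₂) δ ε}) := by
  classical
  obtain ⟨s₁, s₂, hs₁, hs₂, hΩ, hd, hsup⟩ := S.exists_sparsity hS
  have hN1 : (1 : ℝ) ≤ S.supports m₁ m₂ := by
    rw [hsup]
    exact_mod_cast Nat.mul_pos (Nat.choose_pos hs₁) (Nat.choose_pos hs₂)
  obtain ⟨ρ, hρ⟩ : ∃ ρ, ρ = δ / (2 * Real.sqrt n * R ^ 2) := ⟨_, rfl⟩
  -- Positivity of `n` is implied by `hδ` and `hδR`.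
  have hsn : 0 < 2 * Real.sqrt n * R ^ 2 := by linarith
  have hρ0 : 0 < ρ := by rw [hρ]; positivity
  have hρ3 : ρ ≤ 1 / 3 := by
    rw [hρ, div_le_iff₀ hsn]; linarith
  constructor
  · intro hdn M₀ hM₀
    obtain ⟨A, hA1, hA2, hA3⟩ := BlindDeconv.exists_net_omegaB hs₁ hs₂ hρ0
    have hM₀1 : BlindDeconv.frobNorm M₀ ≤ 1 := hM₀.2
    have h := BlindDeconv.one_sub_le_measureReal_of_net hdn hD hE hDE hR hDrows hErows hδ hδR hε hρ
      {X | ∃ M ∈ S.omegaB m₁ m₂, X = M - M₀} (A.image fun M => M - M₀) ?_ ?_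
      (N := (S.supports m₁ m₂ : ℝ) ^ 2) (κ := 676 / 9) (r := 1) (one_le_pow₀ hN1)
      (by norm_num) le_rfl (by norm_num) ?_
    · rw [one_mul] at h
      refine h.trans (measureReal_mono fun ω hω M hM hMδ => ?_)
      exact hω _ ⟨M, hM, rfl⟩ (by rwa [map_sub])
    · intro Z hZ
      obtain ⟨M, hM, rfl⟩ := Finset.mem_image.1 hZ
      linarith [BlindDeconv.frobNorm_sub_le M M₀, hA1 M hM]
    · rintro X ⟨M, hM, rfl⟩
      rw [hΩ] at hM
      obtain ⟨M', hM', hMM'⟩ := hA2 M hM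
      exact ⟨_, Finset.mem_image_of_mem _ hM', by rwa [sub_sub_sub_cancel_right]⟩
    · refine (Nat.cast_le.2 Finset.card_image_le).trans (hA3.trans ?_)
      rw [← hsup, ← hd, pow_mul]
      -- `ρ ≤ 1 / 3` gives `1 + 4 / ρ ≤ 13 / (3ρ)`, whence `κ = 4 (13 / 3)²`.
      have h1 : (1 + 4 / ρ) ^ 2 ≤ 676 / 9 / (4 * ρ ^ 2) := by
        have : 1 + 4 / ρ ≤ 13 / 3 / ρ := by
          rw [le_div_iff₀ hρ0, add_mul, div_mul_cancel₀ _ hρ0.ne']; linarith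
        calc (1 + 4 / ρ) ^ 2 ≤ (13 / 3 / ρ) ^ 2 := by gcongr
          _ = _ := by field_simp; norm_num
      gcongr
      exact le_self_pow₀ hN1 two_ne_zero
  · intro hdn
    -- Radius `ρ / 2` for each matrix gives radius `ρ` for differences; then `κ = 4 (25 / 3)²`,
    -- absorbed by `r = 4`.
    obtain ⟨A, hA1, hA2, hA3⟩ := BlindDeconv.exists_net_omegaB hs₁ hs₂ (half_pos hρ0)
    have h := BlindDeconv.one_sub_le_measureReal_of_net hdn hD hE hDE hR hDrows hErows hδ hδR hε hρ
      {X | ∃ M₁ ∈ S.omegaB m₁ m₂, ∃ M₂ ∈ S.omegaB m₁ m₂, X = M₁ - M₂}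
      ((A ×ˢ A).image fun p => p.1 - p.2) ?_ ?_
      (N := (S.supports m₁ m₂ : ℝ) ^ 4) (κ := 2500 / 9) (r := 4) (one_le_pow₀ hN1)
      (by norm_num) (by norm_num) (by norm_num) ?_
    · refine h.trans (measureReal_mono fun ω hω M₁ hM₁ M₂ hM₂ hMδ => ?_)
      exact hω _ ⟨M₁, hM₁, M₂, hM₂, rfl⟩ (by rwa [map_sub])
    · intro Z hZ
      obtain ⟨p, hp, rfl⟩ := Finset.mem_image.1 hZ
      obtain ⟨hp1, hp2⟩ := Finset.mem_product.1 hp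
      linarith [BlindDeconv.frobNorm_sub_le p.1 p.2, hA1 _ hp1, hA1 _ hp2]
    · rintro X ⟨M₁, hM₁, M₂, hM₂, rfl⟩
      rw [hΩ] at hM₁ hM₂
      obtain ⟨M₁', hM₁', h₁⟩ := hA2 M₁ hM₁
      obtain ⟨M₂', hM₂', h₂⟩ := hA2 M₂ hM₂
      refine ⟨_, Finset.mem_image_of_mem _ (Finset.mk_mem_product hM₁' hM₂'), ?_⟩
      rw [sub_sub_sub_comm]
      linarith [BlindDeconv.frobNorm_sub_le (M₁ - M₁') (M₂ - M₂')]
    · refine (Nat.cast_le.2 Finset.card_image_le).trans ?_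
      rw [Finset.card_product, Nat.cast_mul, ← sq]
      refine (pow_le_pow_left₀ (Nat.cast_nonneg _) hA3 2).trans ?_
      rw [← hsup, ← hd, mul_pow, ← pow_mul, mul_comm _ 2, pow_mul]
      have h1 : (1 + 4 / (ρ / 2)) ^ 2 ≤ 2500 / 9 / (4 * ρ ^ 2) := by
        have : 1 + 4 / (ρ / 2) ≤ 25 / 3 / ρ := by
          rw [le_div_iff₀ hρ0, div_div_eq_mul_div, add_mul, div_mul_cancel₀ _ hρ0.ne']; linarith
        calc (1 + 4 / (ρ / 2)) ^ 2 ≤ (25 / 3 / ρ) ^ 2 := by gcongr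
          _ = _ := by field_simp; norm_num
      gcongr
      norm_num
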